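/- Fix $q\in[0,1]$, $\alpha>0$ and $\beta\in[0,1]$. For $x\in\mathbb{R}^n$ let $\|x\|_q=\big(\sum_{i=1}^n|x_i|^q\big)^{1/q}$ if $q>0$, and let $\|x\|_0$ be the number of nonzero coordinates of $x$; accordingly $|0|^0=0$ throughout. For $\gamma,\nu\ge 0$ and a standard Gaussian random variable $h$ put $$I^{(1)}(\gamma,\nu)=\mathbb{E}\,\sup_{w\in\mathbb{R}}\big(|h||w|+\nu|w|^q-\gamma w^2\big),\qquad I^{(2)}(\gamma,\nu)=\mathbb{E}\,\sup_{w\in\mathbb{R}}\big(|h||w|-\nu|w|^q-\gamma w^2\big),$$ with values in $[0,\infty]$ (and $0\cdot\infty=0$). Suppose that $$\inf_{\gamma\ge 0,\ \nu\ge 0}\Big(\beta\, I^{(1)}(\gamma,\nu)+(1-\beta)\, I^{(2)}(\gamma,\nu)+\gamma\Big)<\sqrt{\alpha}.$$ Then there are constants $C,c>0$, depending only on $q,\alpha,\beta$, such that the following holds for all nonnegative integers $m,n,k$ with $m=\alpha n$ and $k=\beta n$. Let $A$ be a random $m\times n$ matrix with i.i.d. standard Gaussian entries. Then, outside an event of probability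 at most $Ce^{-cn}$, the following holds simultaneously for all $\tilde{x}\in\mathbb{R}^n$ with $\tilde{x}_1=\dots=\tilde{x}_{n-k}=0$ (such vectors are $k$-sparse, i.e. they have at most $k$ nonzero coordinates): with $y=A\tilde{x}$, the problem $$\min_{x\in\mathbb{R}^n}\|x\|_q\quad\text{subject to}\quad Ax=y$$ has $\tilde{x}$ as its unique solution. -/

import Mathlib

open MeasureTheory ProbabilityTheory
open scoped NNReal ENNReal

namespace SectionalLq

/-- The functional `‖x‖_q` on `ℝⁿ`, for `q ≥ 0`: `(∑ |x_i|^q)^(1/q)` when `q > 0`, and the number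
of nonzero coordinates when `q = 0`.
See `lqNorm_zero` and `lqNorm_of_pos`. -/
noncomputable def lqNorm {n : ℕ} (q : ℝ) (x : Fin n → ℝ) : ℝ :=
  ‖WithLp.toLp (ENNReal.ofReal q) x‖

theorem lqNorm_zero {n : ℕ} (x : Fin n → ℝ) :
    lqNorm 0 x = ((Finset.univ.filter fun i => x i ≠ 0).card : ℝ) := by
  unfold lqNorm
  rw [ENNReal.ofReal_zero, PiLp.norm_eq_card]
  congr 1
  rw [← Set.ncard_eq_toFinset_card, ← Set.ncard_coe_finset]
  simp

theorem lqNorm_of_pos {n : ℕ} {q : ℝ} (hq : 0 < q) (x : Fin n → ℝ) :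
    lqNorm q x = (∑ i, |x i| ^ q) ^ (1 / q) := by
  unfold lqNorm
  rw [PiLp.norm_eq_sum (by rwa [ENNReal.toReal_ofReal hq.le])]
  simp [ENNReal.toReal_ofReal hq.le, Real.norm_eq_abs]

/-- The one-dimensional term `|w|^q`, with the convention `|0|^0 = 0` (so that for `q = 0` it is the
indicator of `w ≠ 0`). -/
noncomputable def absPow (q w : ℝ) : ℝ := if w = 0 then 0 else |w| ^ q

/-- `x` solves: minimize `‖z‖_q` subject to `A z = y`. -/
def IsLqSolution {m n : ℕ} (q : ℝ) (A : Matrix (Fin m) (Fin n) ℝ) (y : Fin m → ℝ)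
    (x : Fin n → ℝ) : Prop :=
  A.mulVec x = y ∧ ∀ z : Fin n → ℝ, A.mulVec z = y → lqNorm q x ≤ lqNorm q z

/-- The vectors of `ℝⁿ` whose first `n - k` coordinates vanish.  For `k ≤ n` they automatically have
at most `k` nonzero coordinates. -/
def sectionalVectors (n k : ℕ) : Set (Fin n → ℝ) :=
  {x | ∀ i : Fin n, (i : ℕ) + k < n → x i = 0}

/-- For every `x'` supported on the last `k` coordinates, `ℓ_q`-minimization with data `(A x', A)`
has `x'` as its one and only solution. -/
def RecoversSectional {m n : ℕ} (q : ℝ) (k : ℕ) (A : Matrix (Fin m) (Fin n) ℝ) : Prop :=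
  ∀ x' ∈ sectionalVectors n k, ∀ x : Fin n → ℝ, IsLqSolution q A (A.mulVec x') x ↔ x = x'

/-- `E sup_w (|h||w| + ν|w|^q - γ w²)` for a standard Gaussian `h`.  The choice `w = 0` shows that the
supremum is nonnegative, so it is taken in `[0, ∞]`; it may be infinite, e.g. for `γ = 0`. -/
noncomputable def I1 (q : ℝ) (γ ν : ℝ≥0) : ℝ≥0∞ :=
  ∫⁻ h, ⨆ w : ℝ, ENNReal.ofReal (|h| * |w| + ν * absPow q w - γ * w ^ 2) ∂(gaussianReal 0 1)

/-- `E sup_w (|h||w| - ν|w|^q - γ w²)` for a standard Gaussian `h`, with the same conventions. -/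
noncomputable def I2 (q : ℝ) (γ ν : ℝ≥0) : ℝ≥0∞ :=
  ∫⁻ h, ⨆ w : ℝ, ENNReal.ofReal (|h| * |w| - ν * absPow q w - γ * w ^ 2) ∂(gaussianReal 0 1)

/-- The minimum over `γ, ν ≥ 0` of `β I1 + (1 - β) I2 + γ`. -/
noncomputable def thresholdValue (q β : ℝ) : ℝ≥0∞ :=
  ⨅ (γ : ℝ≥0) (ν : ℝ≥0),
    (ENNReal.ofReal β * I1 q γ ν + ENNReal.ofReal (1 - β) * I2 q γ ν + (γ : ℝ≥0∞))

/-- The entries of the random matrix `A` are independent standard Gaussian random variables. -/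
def IsGaussianMatrix {Ω : Type*} [MeasurableSpace Ω] (P : Measure Ω) {m n : ℕ}
    (A : Ω → Matrix (Fin m) (Fin n) ℝ) : Prop :=
  (∀ i j, HasLaw (fun ω => A ω i j) (gaussianReal 0 1) P) ∧
    iIndepFun (fun (p : Fin m × Fin n) ω => A ω p.1 p.2) P

end SectionalLq

/-! Recovery fails only if the kernel of `A` contains a unit vector `w` whose `q`-mass on the last
`k` coordinates is at least its mass on the others (`exists_mem_badDirections`). Since `|·|^q` is
subadditive for `q ≤ 1`, the normalized difference of two competitors is such a vector. So it
suffices that a Gaussian kernel misses the set `S` of these bad directions.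

Gordon's inequality replaces `|A w| + g₀` by the decoupled process `|g| + ⟨h, w⟩`: if the latter is
at least `ε√n` on all of `S`, up to small probability, then a kernel vector in `S` would force the
scalar `g₀` to be of order `ε√n`, which is exponentially unlikely
(`measure_exists_mulVec_eq_zero_le`). The inequality comes from Gaussian interpolation of a smooth
soft minimum over a finite net. The derivative along the path has a sign because the covariances
differ by `(1 - ⟨w, w'⟩)(1 - ⟨a, a'⟩) ≥ 0`, where `a`, `a'` are gradients of the smoothed norm.

For the decoupled process, `|g|` is close to `√α √n`. Relaxing the norm constraint with multiplier
`γ` and the mass constraint with multiplier `ν` bounds `-√n⟨h, w⟩` by a sum of independent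
one-dimensional suprema plus `γ n` (`sqrt_mul_neg_sum_le`). The mean of this bound is `n (β I1 + (1
- β) I2 + γ)`, which for suitable `γ, ν` is below `n√α` by hypothesis. Chernoff bounds turn the gap
into exponential decay. -/

namespace SectionalLq

/-! ### Gaussian integration by parts and interpolation -/

/-- The standard Gaussian measure on `ι → ℝ`. -/
noncomputable abbrev gaussPi (ι : Type*) [Fintype ι] : Measure (ι → ℝ) :=
  Measure.pi fun _ => gaussianReal 0 1

theorem integrable_abs_gaussianReal : Integrable (fun x : ℝ => |x|) (gaussianReal 0 1) := by
  have h := (memLp_id_gaussianReal (μ := 0) (v := 1) 1).integrable (by simp)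
  simpa using h.abs

theorem hasDerivAt_gaussianPDFReal (x : ℝ) :
    HasDerivAt (gaussianPDFReal 0 1) (-(x * gaussianPDFReal 0 1 x)) x := by
  rw [gaussianPDFReal_def]
  have h : HasDerivAt (fun x : ℝ => -(x - 0) ^ 2 / (2 * ((1 : ℝ≥0) : ℝ))) (-x) x := by
    have h1 := (((hasDerivAt_id x).sub_const 0).pow 2).neg.div_const (2 * ((1 : ℝ≥0) : ℝ))
    exact h1.congr_deriv (by simp; ring)
  exact (h.exp.const_mul (√(2 * Real.pi * ((1 : ℝ≥0) : ℝ)))⁻¹).congr_deriv (by ring)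

/-- Stein's identity in one dimension. -/
theorem integral_mul_gaussianReal {g g' : ℝ → ℝ} {C : ℝ} (hd : ∀ x, HasDerivAt g (g' x) x)
    (hg : ∀ x, |g x| ≤ C) (hg' : ∀ x, |g' x| ≤ C) (hm : Continuous g') :
    ∫ x, x * g x ∂gaussianReal 0 1 = ∫ x, g' x ∂gaussianReal 0 1 := by
  have hgc : Continuous g := continuous_iff_continuousAt.2 fun x => (hd x).continuousAt
  have hI : Integrable (gaussianPDFReal 0 1) := integrable_gaussianPDFReal 0 1
  have hI2 : Integrable fun x => -(x * gaussianPDFReal 0 1 x) := by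
    have h := (integrable_mul_exp_neg_mul_sq (b := 1 / 2) (by norm_num)).const_mul
      (-(√(2 * Real.pi * ((1 : ℝ≥0) : ℝ)))⁻¹)
    refine h.congr (ae_of_all _ fun x => ?_)
    simp only [gaussianPDFReal_def, NNReal.coe_one, sub_zero]
    ring_nf
  -- The density `φ` satisfies `φ' = -xφ`, so integration by parts moves the factor `x` onto a
  -- derivative of `g`.
  have e1 := integral_mul_deriv_eq_deriv_mul_of_integrable (u := g) (u' := g')
    (v := gaussianPDFReal 0 1) (v' := fun x => -(x * gaussianPDFReal 0 1 x))
    (fun x _ => hd x) (fun x _ => hasDerivAt_gaussianPDFReal x)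
    (hI2.bdd_mul hgc.aestronglyMeasurable (ae_of_all _ hg))
    (hI.bdd_mul hm.aestronglyMeasurable (ae_of_all _ hg'))
    (hI.bdd_mul hgc.aestronglyMeasurable (ae_of_all _ hg))
  rw [integral_gaussianReal_eq_integral_smul one_ne_zero,
    integral_gaussianReal_eq_integral_smul one_ne_zero]
  have e2 : ∀ x, gaussianPDFReal 0 1 x • g' x = g' x * gaussianPDFReal 0 1 x :=
    fun x => by simp [mul_comm]
  have e3 : ∀ x, gaussianPDFReal 0 1 x • (x * g x) = -(g x * -(x * gaussianPDFReal 0 1 x)) :=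
    fun x => by simp; ring
  simp_rw [e2, e3]
  rw [integral_neg, e1, neg_neg]

variable {ι : Type*} [Fintype ι]

/-- Resampling one coordinate preserves a product probability measure. -/
theorem measurePreserving_update [DecidableEq ι] (a : ι) :
    MeasurePreserving (fun p : (ι → ℝ) × ℝ => Function.update p.1 a p.2)
      ((gaussPi ι).prod (gaussianReal 0 1)) (gaussPi ι) := by
  have hmeas : Measurable fun p : (ι → ℝ) × ℝ => Function.update p.1 a p.2 := by
    refine measurable_pi_lambda _ fun b => ?_
    by_cases h : b = a
    · subst h; simpa using measurable_snd
    · simpa [Function.update_of_ne h, Function.comp_def] using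
        (measurable_pi_apply b).comp (measurable_fst (α := ι → ℝ) (β := ℝ))
  refine ⟨hmeas, (Measure.pi_eq fun s hs => ?_).symm⟩
  rw [Measure.map_apply hmeas (MeasurableSet.univ_pi hs)]
  have : (fun p : (ι → ℝ) × ℝ => Function.update p.1 a p.2) ⁻¹' Set.univ.pi s
      = (Set.univ.pi (Function.update s a Set.univ)) ×ˢ s a := by
    ext ⟨x, t⟩
    simp only [Set.mem_preimage, Set.mem_pi, Set.mem_univ, true_imp_iff, Set.mem_prod]
    constructor
    · intro h
      refine ⟨fun b => ?_, by simpa using h a⟩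
      by_cases hb : b = a
      · subst hb; simp
      · simpa [Function.update_of_ne hb] using h b
    · rintro ⟨h, ht⟩ b
      by_cases hb : b = a
      · subst hb; simpa using ht
      · simpa [Function.update_of_ne hb] using h b
  rw [this, Measure.prod_prod, Measure.pi_pi]
  have e : ∀ b, gaussianReal 0 1 (Function.update s a Set.univ b)
      = Function.update (fun b => gaussianReal 0 1 (s b)) a 1 b := by
    intro b
    by_cases hb : b = a
    · subst hb; simp
    · simp [Function.update_of_ne hb]
  simp_rw [e]
  rw [Finset.prod_update_of_mem (Finset.mem_univ a), one_mul, mul_comm,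
    ← Finset.prod_erase_mul _ _ (Finset.mem_univ a), Finset.sdiff_singleton_eq_erase, mul_comm,
    mul_comm]

theorem integrable_abs_eval (a : ι) : Integrable (fun x : ι → ℝ => |x a|) (gaussPi ι) :=
  integrable_comp_eval (i := a) integrable_abs_gaussianReal

theorem integrable_eval_mul {G : (ι → ℝ) → ℝ} {C : ℝ} (hc : Continuous G) (hb : ∀ x, |G x| ≤ C)
    (a : ι) : Integrable (fun x : ι → ℝ => x a * G x) (gaussPi ι) := by
  have h : Integrable (fun x : ι → ℝ => x a) (gaussPi ι) :=
    (integrable_norm_iff (measurable_pi_apply a).aestronglyMeasurable).1 (integrable_abs_eval a)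
  exact h.mul_bdd hc.aestronglyMeasurable (ae_of_all _ hb)

theorem integrable_of_bdd {G : (ι → ℝ) → ℝ} {C : ℝ} (hc : Continuous G) (hb : ∀ x, |G x| ≤ C) :
    Integrable G (gaussPi ι) :=
  Integrable.of_bound hc.aestronglyMeasurable C (ae_of_all _ hb)

/-- Gaussian integration by parts in finite dimension. -/
theorem integral_eval_mul [DecidableEq ι] (a : ι) {G G' : (ι → ℝ) → ℝ} {C : ℝ}
    (hd : ∀ x t, HasDerivAt (fun t => G (Function.update x a t)) (G' (Function.update x a t)) t)
    (hG : Continuous G) (hG' : Continuous G') (hb : ∀ x, |G x| ≤ C) (hb' : ∀ x, |G' x| ≤ C) :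
    ∫ x, x a * G x ∂gaussPi ι = ∫ x, G' x ∂gaussPi ι := by
  have hmp := measurePreserving_update a
  have i1 : Integrable (fun x => x a * G x) (gaussPi ι) := integrable_eval_mul hG hb a
  have i2 : Integrable G' (gaussPi ι) := integrable_of_bdd hG' hb'
  -- Resampling coordinate `a` leaves the law unchanged and isolates a one-dimensional Gaussian
  -- integral, to which Stein's identity applies.
  have key : ∀ H : (ι → ℝ) → ℝ, Integrable H (gaussPi ι) →
      ∫ x, H x ∂gaussPi ι
        = ∫ x, ∫ t, H (Function.update x a t) ∂gaussianReal 0 1 ∂gaussPi ι := by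
    intro H hH
    have h2 : Integrable (fun p : (ι → ℝ) × ℝ => H (Function.update p.1 a p.2))
        ((gaussPi ι).prod (gaussianReal 0 1)) := hmp.integrable_comp_of_integrable hH
    have h1 := integral_map (μ := (gaussPi ι).prod (gaussianReal 0 1)) hmp.measurable.aemeasurable
      (by rw [hmp.map_eq]; exact hH.aestronglyMeasurable) (f := H)
    rw [hmp.map_eq] at h1
    rw [h1, integral_prod _ h2]
  rw [key _ i1, key _ i2]
  congr 1
  ext x
  have hu : Continuous fun t => Function.update x a t := continuous_const.update a continuous_id
  simpa using integral_mul_gaussianReal (hd x) (fun t => hb _) (fun t => hb' _) (hG'.comp hu)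

/-- Derivative of the expectation of a smooth function along a path of rescalings. -/
theorem hasDerivAt_integral_rescale [DecidableEq ι] {G : (ι → ℝ) → ℝ} {G1 G2 : ι → (ι → ℝ) → ℝ}
    {C : ℝ}
    (hd : ∀ y, HasFDerivAt G (∑ a, G1 a y • ContinuousLinearMap.proj (R := ℝ) a) y)
    (hd2 : ∀ a x t, HasDerivAt (fun t => G1 a (Function.update x a t))
      (G2 a (Function.update x a t)) t)
    (hc1 : ∀ a, Continuous (G1 a)) (hc2 : ∀ a, Continuous (G2 a))
    (hb : ∀ y, |G y| ≤ C) (hb1 : ∀ a y, |G1 a y| ≤ C) (hb2 : ∀ a y, |G2 a y| ≤ C)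
    {c c' : ι → ℝ → ℝ} (hcd : ∀ a θ, HasDerivAt (c a) (c' a θ) θ)
    (hcb : ∀ a θ, |c a θ| ≤ 1) (hcb' : ∀ a θ, |c' a θ| ≤ 1) (θ : ℝ) :
    HasDerivAt (fun θ => ∫ x, G (fun a => c a θ * x a) ∂gaussPi ι)
      (∑ a, c' a θ * c a θ * ∫ x, G2 a (fun a => c a θ * x a) ∂gaussPi ι) θ := by
  have hG : Continuous G := continuous_iff_continuousAt.2 fun y => (hd y).continuousAt
  have hC : 0 ≤ C := (abs_nonneg _).trans (hb 0)
  have hsc : ∀ θ, Continuous fun (x : ι → ℝ) a => c a θ * x a := fun θ => by fun_prop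
  have hcomp : ∀ (x : ι → ℝ) θ, HasDerivAt (fun θ => G (fun a => c a θ * x a))
      (∑ a, G1 a (fun a => c a θ * x a) * (c' a θ * x a)) θ := by
    intro x θ
    have h1 : HasDerivAt (fun θ a => c a θ * x a) (fun a => c' a θ * x a) θ :=
      hasDerivAt_pi.2 fun a => (hcd a θ).mul_const _
    have h2 := (hd (fun a => c a θ * x a)).comp_hasDerivAt θ h1
    exact h2.congr_deriv (by simp [sum_apply])
  have hmain := hasDerivAt_integral_of_dominated_loc_of_deriv_le (μ := gaussPi ι) (x₀ := θ)
    (s := Set.univ) (F := fun θ x => G (fun a => c a θ * x a))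
    (F' := fun θ x => ∑ a, G1 a (fun a => c a θ * x a) * (c' a θ * x a))
    (bound := fun x => ∑ a, C * |x a|) Filter.univ_mem
    (Filter.Eventually.of_forall fun θ => (hG.comp (hsc θ)).aestronglyMeasurable)
    (integrable_of_bdd (hG.comp (hsc θ)) fun x => hb _)
    (Continuous.aestronglyMeasurable (continuous_finsetSum _ fun a _ =>
      ((hc1 a).comp (hsc θ)).mul (by fun_prop)))
    (ae_of_all _ fun x θ _ => by
      refine (norm_sum_le _ _).trans (Finset.sum_le_sum fun a _ => ?_)
      rw [Real.norm_eq_abs, abs_mul, abs_mul]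
      have := mul_le_mul_of_nonneg_right (hcb' a θ) (abs_nonneg (x a))
      exact mul_le_mul (hb1 a _) (by linarith) (by positivity) hC)
    (integrable_finsetSum _ fun a _ => (integrable_abs_eval a).const_mul C)
    (ae_of_all _ fun x θ _ => hcomp x θ)
  refine hmain.2.congr_deriv ?_
  have hI : ∀ a, Integrable (fun x : ι → ℝ => G1 a (fun a => c a θ * x a) * (c' a θ * x a))
      (gaussPi ι) := fun a => by
    have := (integrable_eval_mul ((hc1 a).comp (hsc θ)) (fun x => hb1 a _) a).const_mul (c' a θ)
    refine this.congr (ae_of_all _ fun x => ?_)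
    simp only [Function.comp]
    ring
  rw [integral_finsetSum _ fun a _ => hI a]
  refine Finset.sum_congr rfl fun a _ => ?_
  have hupd : ∀ (x : ι → ℝ) t, (fun b => c b θ * Function.update x a t b)
      = Function.update (fun b => c b θ * x b) a (c a θ * t) := by
    intro x t
    ext b
    by_cases h : b = a
    · subst h; simp
    · simp [Function.update_of_ne h]
  -- Integration by parts removes the factor `x a` and supplies the second derivative together with
  -- the factor `c a θ` from the chain rule.
  have hibp := integral_eval_mul a (G := fun x => G1 a (fun a => c a θ * x a))
    (G' := fun x => c a θ * G2 a (fun a => c a θ * x a)) (C := C)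
    (fun x t => by
      simp only [hupd]
      have h1 : HasDerivAt (fun t => c a θ * t) (c a θ) t := by
        simpa using (hasDerivAt_id t).const_mul (c a θ)
      have h2 := (hd2 a (fun b => c b θ * x b) (c a θ * t)).comp t h1
      simpa [mul_comm, Function.comp_def] using h2)
    ((hc1 a).comp (hsc θ)) (continuous_const.mul ((hc2 a).comp (hsc θ))) (fun x => hb1 a _)
    (fun x => by
      rw [abs_mul]
      nlinarith [hcb a θ, hb2 a (fun a => c a θ * x a), abs_nonneg (c a θ),
        abs_nonneg (G2 a (fun a => c a θ * x a))])
  rw [integral_const_mul] at hibp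
  rw [mul_assoc, ← hibp, ← integral_const_mul]
  exact integral_congr_ae (ae_of_all _ fun x => by simp only; ring)

/-- Gaussian comparison by interpolation: if the trace of the Hessian over the first block of
coordinates dominates the trace over the second block, then switching on the first block gives the
larger expectation. -/
theorem integral_comparison {κ : Type*} [Fintype κ] [DecidableEq ι] [DecidableEq κ]
    {G : (ι ⊕ κ → ℝ) → ℝ} {G1 G2 : ι ⊕ κ → (ι ⊕ κ → ℝ) → ℝ} {C : ℝ}
    (hd : ∀ y, HasFDerivAt G (∑ a, G1 a y • ContinuousLinearMap.proj (R := ℝ) a) y)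
    (hd2 : ∀ a x t, HasDerivAt (fun t => G1 a (Function.update x a t))
      (G2 a (Function.update x a t)) t)
    (hc1 : ∀ a, Continuous (G1 a)) (hc2 : ∀ a, Continuous (G2 a))
    (hb : ∀ y, |G y| ≤ C) (hb1 : ∀ a y, |G1 a y| ≤ C) (hb2 : ∀ a y, |G2 a y| ≤ C)
    (htr : ∀ y, ∑ b, G2 (Sum.inr b) y ≤ ∑ a, G2 (Sum.inl a) y) :
    ∫ x, G (Sum.elim 0 fun b => x (Sum.inr b)) ∂gaussPi (ι ⊕ κ)
      ≤ ∫ x, G (Sum.elim (fun a => x (Sum.inl a)) 0) ∂gaussPi (ι ⊕ κ) := by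
  -- Rotating from one block to the other makes `c' * c` equal to `sin θ cos θ` on the first block
  -- and to its negative on the second, so the derivative is a nonnegative multiple of the
  -- difference of traces.
  set c : ι ⊕ κ → ℝ → ℝ := Sum.elim (fun _ => Real.sin) (fun _ => Real.cos) with hcdef
  set c' : ι ⊕ κ → ℝ → ℝ := Sum.elim (fun _ => Real.cos) (fun _ θ => -Real.sin θ) with hcdef'
  have hder := hasDerivAt_integral_rescale hd hd2 hc1 hc2 hb hb1 hb2 (c := c) (c' := c')
    (by rintro (a | a) θ; exacts [Real.hasDerivAt_sin θ, Real.hasDerivAt_cos θ])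
    (by rintro (a | a) θ; exacts [Real.abs_sin_le_one θ, Real.abs_cos_le_one θ])
    (by
      rintro (a | a) θ
      · exact Real.abs_cos_le_one θ
      · simpa [hcdef'] using Real.abs_sin_le_one θ)
  set F : ℝ → ℝ := fun θ => ∫ x, G (fun a => c a θ * x a) ∂gaussPi (ι ⊕ κ) with hF
  have hmono : MonotoneOn F (Set.Icc 0 (Real.pi / 2)) := by
    refine monotoneOn_of_deriv_nonneg (convex_Icc _ _)
      (fun θ _ => (hder θ).continuousAt.continuousWithinAt)
      (fun θ _ => (hder θ).differentiableAt.differentiableWithinAt) fun θ hθ => ?_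
    rw [interior_Icc] at hθ
    rw [(hder θ).deriv, Fintype.sum_sum_type]
    simp only [hcdef, hcdef', Sum.elim_inl, Sum.elim_inr]
    have hs : 0 ≤ Real.sin θ :=
      Real.sin_nonneg_of_nonneg_of_le_pi hθ.1.le (by linarith [hθ.2, Real.pi_pos])
    have hco : 0 ≤ Real.cos θ := Real.cos_nonneg_of_neg_pi_div_two_le_of_le
      (by linarith [hθ.1, Real.pi_pos]) hθ.2.le
    have hint : ∀ a, Integrable (fun x => G2 a (fun a => c a θ * x a)) (gaussPi (ι ⊕ κ)) :=
      fun a => integrable_of_bdd ((hc2 a).comp (by fun_prop)) fun x => hb2 a _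
    have hle : ∑ b, ∫ x, G2 (Sum.inr b) (fun a => c a θ * x a) ∂gaussPi (ι ⊕ κ)
        ≤ ∑ a, ∫ x, G2 (Sum.inl a) (fun a => c a θ * x a) ∂gaussPi (ι ⊕ κ) := by
      rw [← integral_finsetSum _ fun a _ => hint _, ← integral_finsetSum _ fun a _ => hint _]
      exact integral_mono (integrable_finsetSum _ fun a _ => hint _)
        (integrable_finsetSum _ fun a _ => hint _) fun x => htr _
    rw [← Finset.mul_sum, ← Finset.mul_sum]
    nlinarith [mul_nonneg hs hco]
  have h := hmono (Set.left_mem_Icc.2 (by positivity)) (Set.right_mem_Icc.2 (by positivity))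
    (by positivity : (0 : ℝ) ≤ Real.pi / 2)
  have e0 : F 0 = ∫ x, G (Sum.elim 0 fun b => x (Sum.inr b)) ∂gaussPi (ι ⊕ κ) := by
    refine integral_congr_ae (ae_of_all _ fun x => congrArg G ?_)
    ext (a | a) <;> simp [hcdef]
  have e1 : F (Real.pi / 2) = ∫ x, G (Sum.elim (fun a => x (Sum.inl a)) 0) ∂gaussPi (ι ⊕ κ) := by
    refine integral_congr_ae (ae_of_all _ fun x => congrArg G ?_)
    ext (a | a) <;> simp [hcdef]
  rwa [e0, e1] at h

end SectionalLq

namespace SectionalLq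

/-! ### Gordon's comparison for finitely many unit vectors -/

/-- The coordinate functional. -/
noncomputable abbrev coord {B : Type*} (β : B) : (B → ℝ) →L[ℝ] ℝ := ContinuousLinearMap.proj β

theorem sum_proj_apply {B : Type*} [Fintype B] (c x : B → ℝ) :
    (∑ β, c β • coord β) x = ∑ β, c β * x β := by
  simp [sum_apply]

/-! ### Derivatives and bounds of the soft minimum -/

section SoftMin

variable {ι B J : Type*} [Fintype ι] [DecidableEq B] [Fintype J]

/-- The linear map sending `y` to the vector with coordinates `∑_{b a = β} κ a * y a`. -/
noncomputable def fiberSum (b : ι → B) (κ : ι → ℝ) : (ι → ℝ) →L[ℝ] (B → ℝ) :=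
  ContinuousLinearMap.pi fun β =>
    ∑ a, (if b a = β then κ a else 0) • coord a

theorem fiberSum_apply (b : ι → B) (κ : ι → ℝ) (y : ι → ℝ) (β : B) :
    fiberSum b κ y β = ∑ a, (if b a = β then κ a else 0) * y a := by
  simp only [fiberSum, ContinuousLinearMap.pi_apply, sum_apply, _root_.smul_apply,
    ContinuousLinearMap.proj_apply, smul_eq_mul]

theorem fiberSum_single [DecidableEq ι] (b : ι → B) (κ : ι → ℝ) (a : ι) :
    fiberSum b κ (Pi.single a 1) = κ a • Pi.single (b a) 1 := by
  ext β
  rw [fiberSum_apply]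
  simp only [Pi.single_apply, mul_ite, mul_one, mul_zero, Finset.sum_ite_eq', Finset.mem_univ,
    if_true, Pi.smul_apply, smul_eq_mul]
  simp [eq_comm]

theorem mul_exp_neg_le (x : ℝ) : x * Real.exp (-x) ≤ 1 := by
  have h := Real.add_one_le_exp x
  rw [Real.exp_neg]
  exact (mul_inv_le_iff₀ (Real.exp_pos x)).2 (by linarith)

/-- This is four times the square of `(x / 2) * exp (-(x / 2)) ≤ 1`. -/
theorem sq_mul_exp_neg_le {x : ℝ} (hx : 0 ≤ x) : x ^ 2 * Real.exp (-x) ≤ 4 := by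
  have h := mul_exp_neg_le (x / 2)
  have h0 : 0 ≤ x / 2 * Real.exp (-(x / 2)) := by positivity
  have e : x ^ 2 * Real.exp (-x) = 4 * (x / 2 * Real.exp (-(x / 2))) ^ 2 := by
    rw [mul_pow, ← Real.exp_nat_mul]
    push_cast
    ring_nf
  rw [e]
  nlinarith

variable (ψ : (B → ℝ) → ℝ) (ψ1 ψ2 : B → (B → ℝ) → ℝ) (b : ι → B) (κ : ι → J → ℝ)

/-- `exp (-∑ ψ)` along finitely many linear images of the Gaussian vector. -/
noncomputable def softMin (y : ι → ℝ) : ℝ :=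
  Real.exp (-∑ u, ψ (fiberSum b (κ · u) y))

/-- First partial derivatives of `softMin`. -/
noncomputable def softMin1 (a : ι) (y : ι → ℝ) : ℝ :=
  -(softMin ψ b κ y * ∑ u, κ a u * ψ1 (b a) (fiberSum b (κ · u) y))

/-- Second (pure) partial derivatives of `softMin`. -/
noncomputable def softMin2 (a : ι) (y : ι → ℝ) : ℝ :=
  softMin ψ b κ y * ((∑ u, κ a u * ψ1 (b a) (fiberSum b (κ · u) y)) ^ 2
    - ∑ u, κ a u ^ 2 * ψ2 (b a) (fiberSum b (κ · u) y))

variable {ψ ψ1 ψ2}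

theorem hasFDerivAt_softMin [DecidableEq ι] [Fintype B]
    (h1 : ∀ p, HasFDerivAt ψ (∑ β, ψ1 β p • coord β) p) (y : ι → ℝ) :
    HasFDerivAt (softMin ψ b κ)
      (∑ a, softMin1 ψ ψ1 b κ a y • coord a) y := by
  have h := (HasFDerivAt.fun_sum (u := Finset.univ) fun u _ =>
    (h1 (fiberSum b (κ · u) y)).comp y (fiberSum b (κ · u)).hasFDerivAt).neg.exp
  refine h.congr_fderiv ?_
  refine ContinuousLinearMap.coe_injective (LinearMap.pi_ext' fun a => LinearMap.ext_ring ?_)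
  simp only [LinearMap.comp_apply, ContinuousLinearMap.coe_coe, LinearMap.coe_single]
  rw [sum_proj_apply]
  simp only [Pi.single_apply, mul_ite, mul_one, mul_zero, Finset.sum_ite_eq', Finset.mem_univ,
    if_true]
  simp only [_root_.smul_apply, _root_.neg_apply, sum_apply,
    ContinuousLinearMap.comp_apply, fiberSum_single, map_smul, softMin1, softMin,
    ContinuousLinearMap.proj_apply, smul_eq_mul, Pi.single_apply, mul_ite, mul_one, mul_zero,
    Finset.sum_ite_eq', Finset.mem_univ, if_true, Function.comp_apply, mul_neg]
  rfl

theorem hasDerivAt_softMin1 [DecidableEq ι] [Fintype B]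
    (h1 : ∀ p, HasFDerivAt ψ (∑ β, ψ1 β p • coord β) p)
    (h2 : ∀ β p, ∃ D : (B → ℝ) →L[ℝ] ℝ, HasFDerivAt (ψ1 β) D p ∧ D (Pi.single β 1) = ψ2 β p)
    (a : ι) (x : ι → ℝ) (t : ℝ) :
    HasDerivAt (fun t => softMin1 ψ ψ1 b κ a (Function.update x a t))
      (softMin2 ψ ψ1 ψ2 b κ a (Function.update x a t)) t := by
  have hu := hasDerivAt_update x a t
  set y := Function.update x a t with hy
  have hG := (hasFDerivAt_softMin b κ h1 y).comp_hasDerivAt t hu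
  rw [sum_proj_apply] at hG
  have hS : HasDerivAt (fun t => ∑ u, κ a u *
      ψ1 (b a) (fiberSum b (κ · u) (Function.update x a t)))
      (∑ u, κ a u ^ 2 * ψ2 (b a) (fiberSum b (κ · u) y)) t := by
    refine HasDerivAt.fun_sum fun u _ => ?_
    obtain ⟨D, hD, hD'⟩ := h2 (b a) (fiberSum b (κ · u) y)
    have h3 := (fiberSum b (κ · u)).hasFDerivAt.comp_hasDerivAt t hu
    have h4 := (hD.comp_hasDerivAt t h3).const_mul (κ a u)
    rw [fiberSum_single, map_smul, hD'] at h4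
    exact h4.congr_deriv (by simp; ring)
  refine (hG.mul hS).neg.congr_deriv ?_
  simp only [Pi.single_apply, mul_ite, mul_one, mul_zero, Finset.sum_ite_eq', Finset.mem_univ,
    if_true, softMin1, softMin2, Function.comp_apply]
  ring

/-- With `H = ∑ ψ`, the derivatives are at most polynomials in `K * H` times `exp (-H)`, hence
bounded although `ψ` itself grows exponentially. This supplies the domination required by the
interpolation. -/
theorem softMin_bounds {K : ℝ} (hK : 0 ≤ K) (h0 : ∀ p, 0 ≤ ψ p) (hb1 : ∀ β p, |ψ1 β p| ≤ K * ψ p)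
    (hb2 : ∀ β p, |ψ2 β p| ≤ K * ψ p) (hκ : ∀ a u, |κ a u| ≤ 1) (y : ι → ℝ) :
    |softMin ψ b κ y| ≤ 1 + K + 4 * K ^ 2 ∧
    (∀ a, |softMin1 ψ ψ1 b κ a y| ≤ 1 + K + 4 * K ^ 2) ∧
    ∀ a, |softMin2 ψ ψ1 ψ2 b κ a y| ≤ 1 + K + 4 * K ^ 2 := by
  set H := ∑ u, ψ (fiberSum b (κ · u) y) with hH
  have hH0 : 0 ≤ H := Finset.sum_nonneg fun u _ => h0 _
  have hs : softMin ψ b κ y = Real.exp (-H) := rfl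
  have e1 := mul_exp_neg_le H
  have e2 := sq_mul_exp_neg_le hH0
  have e0 : Real.exp (-H) ≤ 1 := Real.exp_le_one_iff.2 (by linarith)
  have ep := Real.exp_pos (-H)
  have hS1 : ∀ a, |∑ u, κ a u * ψ1 (b a) (fiberSum b (κ · u) y)| ≤ K * H := fun a => by
    rw [hH, Finset.mul_sum]
    refine (Finset.abs_sum_le_sum_abs _ _).trans (Finset.sum_le_sum fun u _ => ?_)
    rw [abs_mul]
    nlinarith [hκ a u, hb1 (b a) (fiberSum b (κ · u) y), abs_nonneg (κ a u),
      abs_nonneg (ψ1 (b a) (fiberSum b (κ · u) y))]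
  have hS2 : ∀ a, |∑ u, κ a u ^ 2 * ψ2 (b a) (fiberSum b (κ · u) y)| ≤ K * H := fun a => by
    rw [hH, Finset.mul_sum]
    refine (Finset.abs_sum_le_sum_abs _ _).trans (Finset.sum_le_sum fun u _ => ?_)
    rw [abs_mul, abs_pow]
    have : |κ a u| ^ 2 ≤ 1 := pow_le_one₀ (abs_nonneg _) (hκ a u)
    nlinarith [hb2 (b a) (fiberSum b (κ · u) y), sq_nonneg |κ a u|,
      abs_nonneg (ψ2 (b a) (fiberSum b (κ · u) y))]
  have hKe : K * H * Real.exp (-H) ≤ K := by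
    have := mul_le_mul_of_nonneg_left e1 hK
    linarith
  refine ⟨?_, fun a => ?_, fun a => ?_⟩
  · rw [hs, abs_of_pos ep]; nlinarith
  · rw [softMin1, hs, abs_neg, abs_mul, abs_of_pos ep]
    have := mul_le_mul_of_nonneg_left (hS1 a) ep.le
    nlinarith
  · rw [softMin2, hs, abs_mul, abs_of_pos ep]
    have h3 := mul_le_mul_of_nonneg_left (hS2 a) ep.le
    have h4 : (∑ u, κ a u * ψ1 (b a) (fiberSum b (κ · u) y)) ^ 2 ≤ (K * H) ^ 2 :=
      sq_le_sq' (by linarith [neg_le_of_abs_le (hS1 a)]) (le_of_abs_le (hS1 a))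
    have h5 := mul_le_mul_of_nonneg_left h4 ep.le
    have h6 := mul_le_mul_of_nonneg_left e2 (sq_nonneg K)
    have h7 := abs_sub ((∑ u, κ a u * ψ1 (b a) (fiberSum b (κ · u) y)) ^ 2)
      (∑ u, κ a u ^ 2 * ψ2 (b a) (fiberSum b (κ · u) y))
    rw [abs_of_nonneg (sq_nonneg (∑ u, κ a u * ψ1 (b a) (fiberSum b (κ · u) y)))] at h7
    have h8 := mul_le_mul_of_nonneg_left h7 ep.le
    nlinarith

end SoftMin

/-! ### The smoothed norm and its exponential potential -/

section Potential

variable {m : ℕ}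

/-- A smooth surrogate of the Euclidean norm of the `some`-coordinates. -/
noncomputable def smoothNorm (z : Fin m → ℝ) : ℝ := √(1 + ∑ i, z i ^ 2)

theorem smoothNorm_sq (z : Fin m → ℝ) : smoothNorm z ^ 2 = 1 + ∑ i, z i ^ 2 :=
  Real.sq_sqrt (by positivity)

theorem one_le_smoothNorm (z : Fin m → ℝ) : 1 ≤ smoothNorm z :=
  Real.one_le_sqrt.2 (by linarith [Finset.sum_nonneg fun i (_ : i ∈ Finset.univ) => sq_nonneg (z i)])

theorem abs_le_smoothNorm (z : Fin m → ℝ) (i : Fin m) : |z i| ≤ smoothNorm z := by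
  refine Real.abs_le_sqrt ?_
  have := Finset.single_le_sum (f := fun i => z i ^ 2) (fun i _ => sq_nonneg (z i))
    (Finset.mem_univ i)
  linarith

theorem continuous_smoothNorm : Continuous (smoothNorm (m := m)) := by
  unfold smoothNorm; fun_prop

/-- The exponential potential of the process `N(z) + s - t`. -/
noncomputable def potential (l t : ℝ) (p : Option (Fin m) → ℝ) : ℝ :=
  Real.exp (-(l * (smoothNorm (fun i => p (some i)) + p none - t)))

/-- The gradient of `N(z) + s`. -/
noncomputable def slope : Option (Fin m) → (Option (Fin m) → ℝ) → ℝ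
  | none, _ => 1
  | some i, p => p (some i) / smoothNorm (fun i => p (some i))

/-- The pure second derivatives of `N(z) + s`. -/
noncomputable def curvature : Option (Fin m) → (Option (Fin m) → ℝ) → ℝ
  | none, _ => 0
  | some i, p => (1 - slope (some i) p ^ 2) / smoothNorm (fun i => p (some i))

theorem hasFDerivAt_smoothNorm (p : Option (Fin m) → ℝ) :
    HasFDerivAt (fun p : Option (Fin m) → ℝ => smoothNorm fun i => p (some i))
      (∑ i, slope (some i) p • coord (some i)) p := by
  have h1 : HasFDerivAt (fun p : Option (Fin m) → ℝ => 1 + ∑ i, p (some i) ^ 2)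
      (∑ i, (2 * p (some i)) • coord (some i)) p := by
    refine (HasFDerivAt.fun_sum fun i _ => ?_).const_add 1
    have h := (coord (some i : Option (Fin m))).hasFDerivAt (x := p)
    exact (h.pow 2).congr_fderiv (by simp)
  have hne : 1 + ∑ i, p (some i) ^ 2 ≠ 0 := by positivity
  refine (h1.sqrt hne).congr_fderiv ?_
  rw [Finset.smul_sum]
  refine Finset.sum_congr rfl fun i _ => ?_
  rw [smul_smul]
  congr 1
  simp only [slope, smoothNorm]
  have := Real.sqrt_ne_zero'.2 (lt_of_le_of_ne (by positivity) hne.symm)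
  field_simp

theorem hasFDerivAt_potential (l t : ℝ) (p : Option (Fin m) → ℝ) :
    HasFDerivAt (potential l t)
      (∑ β, (-(l * potential l t p * slope β p)) • coord β) p := by
  have h0 := (coord (none : Option (Fin m))).hasFDerivAt (x := p)
  have h := ((((hasFDerivAt_smoothNorm p).add h0).sub_const t).const_mul l).neg.exp
  refine h.congr_fderiv ?_
  rw [Fintype.sum_option, smul_neg, smul_smul, smul_add, Finset.smul_sum, neg_add, add_comm,
    ← Finset.sum_neg_distrib]
  congr 1
  · rw [← neg_smul]; congr 1; simp [slope, potential, mul_comm]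
  · refine Finset.sum_congr rfl fun i _ => ?_
    ext x
    simp [potential]
    ring

/-- Only pure second derivatives enter the interpolation formula, so the full derivative can stay
existential. -/
theorem exists_hasFDerivAt_slope (β : Option (Fin m)) (p : Option (Fin m) → ℝ) :
    ∃ D : (Option (Fin m) → ℝ) →L[ℝ] ℝ, HasFDerivAt (slope β) D p ∧
      D (Pi.single β 1) = curvature β p := by
  rcases β with _ | i
  · exact ⟨0, hasFDerivAt_const _ _, by simp [curvature]⟩
  · have hN : smoothNorm (fun i => p (some i)) ≠ 0 :=
      (lt_of_lt_of_le one_pos (one_le_smoothNorm _)).ne'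
    have h0 := (coord (some i : Option (Fin m))).hasFDerivAt (x := p)
    have h := h0.mul ((hasDerivAt_inv hN).comp_hasFDerivAt p (hasFDerivAt_smoothNorm p))
    refine ⟨_, h.congr_of_eventuallyEq (Filter.Eventually.of_forall fun p => ?_), ?_⟩
    · simp [slope, div_eq_mul_inv]
    · simp [curvature, slope, sum_apply, Pi.single_apply]
      field_simp
      ring

theorem exists_hasFDerivAt_potential1 (l t : ℝ) (β : Option (Fin m)) (p : Option (Fin m) → ℝ) :
    ∃ D : (Option (Fin m) → ℝ) →L[ℝ] ℝ,
      HasFDerivAt (fun p => -(l * potential l t p * slope β p)) D p ∧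
      D (Pi.single β 1) = potential l t p * (l ^ 2 * slope β p ^ 2 - l * curvature β p) := by
  obtain ⟨D, hD, hD'⟩ := exists_hasFDerivAt_slope β p
  refine ⟨_, ((((hasFDerivAt_potential l t p).const_mul l).mul hD)).neg, ?_⟩
  simp only [_root_.neg_apply, _root_.add_apply,
    _root_.smul_apply, hD', sum_proj_apply, smul_eq_mul, Pi.single_apply, mul_ite,
    mul_one, mul_zero, Finset.sum_ite_eq', Finset.mem_univ, if_true]
  ring

theorem abs_slope_le_one (β : Option (Fin m)) (p : Option (Fin m) → ℝ) : |slope β p| ≤ 1 := by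
  rcases β with _ | i
  · simp [slope]
  · have h1 := one_le_smoothNorm fun i => p (some i)
    simp only [slope, abs_div]
    rw [abs_of_pos (lt_of_lt_of_le one_pos h1)]
    exact (div_le_one (lt_of_lt_of_le one_pos h1)).2 (abs_le_smoothNorm (fun i => p (some i)) i)

theorem abs_curvature_le_one (β : Option (Fin m)) (p : Option (Fin m) → ℝ) :
    |curvature β p| ≤ 1 := by
  rcases β with _ | i
  · simp [curvature]
  · have h1 := one_le_smoothNorm fun i => p (some i)
    have h2 := abs_slope_le_one (some i) p
    have h3 : slope (some i) p ^ 2 ≤ 1 := (sq_le_one_iff_abs_le_one _).2 h2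
    have h4 := sq_nonneg (slope (some i) p)
    have hp := lt_of_lt_of_le one_pos h1
    rw [curvature, abs_div, abs_of_pos hp, div_le_one hp, abs_of_nonneg (by linarith)]
    linarith

theorem continuous_slope (β : Option (Fin m)) : Continuous (slope β) := by
  rcases β with _ | i
  · exact continuous_const
  · exact (continuous_apply _).div (continuous_smoothNorm.comp (by fun_prop))
      fun p => (lt_of_lt_of_le one_pos (one_le_smoothNorm _)).ne'

theorem continuous_curvature (β : Option (Fin m)) : Continuous (curvature β) := by
  rcases β with _ | i
  · exact continuous_const
  · exact (continuous_const.sub ((continuous_slope _).pow 2)).div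
      (continuous_smoothNorm.comp (by fun_prop))
      fun p => (lt_of_lt_of_le one_pos (one_le_smoothNorm _)).ne'

theorem continuous_potential (l t : ℝ) : Continuous (potential (m := m) l t) :=
  continuous_iff_continuousAt.2 fun p => (hasFDerivAt_potential l t p).continuousAt

/-- The gradient of the smoothed norm has Euclidean length at most `1`, as for the norm itself. This
is the only property of the norm that Gordon's covariance comparison needs. -/
theorem sum_slope_mul_slope_le (p p' : Option (Fin m) → ℝ) :
    ∑ i, slope (some i) p * slope (some i) p' ≤ 1 := by
  have hle : ∀ p : Option (Fin m) → ℝ, ∑ i, slope (some i) p ^ 2 ≤ 1 := fun p => by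
    have h1 := one_le_smoothNorm fun i => p (some i)
    have hp := lt_of_lt_of_le one_pos h1
    simp only [slope, div_pow]
    rw [← Finset.sum_div, div_le_one (by positivity), smoothNorm_sq]
    linarith
  have h : ∀ i, slope (some i) p * slope (some i) p'
      ≤ (slope (some i) p ^ 2 + slope (some i) p' ^ 2) / 2 := fun i => by
    nlinarith [sq_nonneg (slope (some i) p - slope (some i) p')]
  refine (Finset.sum_le_sum fun i _ => h i).trans ?_
  rw [← Finset.sum_div, Finset.sum_add_distrib]
  linarith [hle p, hle p']

end Potential

end SectionalLq

namespace SectionalLq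

/-! ### Covariance comparison and Gordon's inequality -/

section Gordon

variable {m n : ℕ} {J : Type*} [Fintype J]

/-- As each `w u` is a unit vector, the terms in `d` and `e` agree on both sides. What remains is
right side minus left side equal to the sum over `u, v` of `(1 - ⟨w u, w v⟩) * (c u * c v - ⟨a u, a
v⟩)`, and both factors are nonnegative. -/
theorem gordon_trace_le {w : J → Fin n → ℝ} (hw : ∀ u, ∑ j, w u j ^ 2 = 1) {a d : J → Fin m → ℝ}
    {c e : J → ℝ} (hac : ∀ u v, ∑ i, a u i * a v i ≤ c u * c v) :
    (∑ i, ((∑ u, a u i) ^ 2 - ∑ u, d u i)) + ∑ j, ((∑ u, w u j * c u) ^ 2 - ∑ u, w u j ^ 2 * e u)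
      ≤ (∑ ij : Fin m × Fin n, ((∑ u, w u ij.2 * a u ij.1) ^ 2 - ∑ u, w u ij.2 ^ 2 * d u ij.1))
        + ((∑ u, c u) ^ 2 - ∑ u, e u) := by
  have hd : ∑ ij : Fin m × Fin n, ∑ u, w u ij.2 ^ 2 * d u ij.1 = ∑ i, ∑ u, d u i := by
    rw [Fintype.sum_prod_type]
    refine Finset.sum_congr rfl fun i _ => ?_
    rw [Finset.sum_comm]
    refine Finset.sum_congr rfl fun u _ => ?_
    simp only
    rw [← Finset.sum_mul, hw, one_mul]
  have he : ∑ j, ∑ u, w u j ^ 2 * e u = ∑ u, e u := by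
    rw [Finset.sum_comm]
    refine Finset.sum_congr rfl fun u _ => ?_
    rw [← Finset.sum_mul, hw, one_mul]
  have sq : ∀ f : J → ℝ, (∑ u, f u) ^ 2 = ∑ u, ∑ v, f u * f v := fun f => by
    rw [pow_two, Finset.sum_mul_sum]
  have swap : ∀ {K : Type} [Fintype K] (f : K → J → J → ℝ),
      ∑ k, ∑ u, ∑ v, f k u v = ∑ u, ∑ v, ∑ k, f k u v := fun f => by
    rw [Finset.sum_comm]
    exact Finset.sum_congr rfl fun u _ => Finset.sum_comm
  have h1 : ∑ ij : Fin m × Fin n, (∑ u, w u ij.2 * a u ij.1) ^ 2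
      = ∑ u, ∑ v, (∑ i, a u i * a v i) * ∑ j, w u j * w v j := by
    simp_rw [sq]
    rw [swap]
    refine Finset.sum_congr rfl fun u _ => Finset.sum_congr rfl fun v _ => ?_
    rw [Finset.sum_mul_sum, Fintype.sum_prod_type]
    exact Finset.sum_congr rfl fun i _ => Finset.sum_congr rfl fun j _ => by ring
  have h2 : ∑ i, (∑ u, a u i) ^ 2 = ∑ u, ∑ v, ∑ i, a u i * a v i := by
    simp_rw [sq]; rw [swap]
  have h3 : ∑ j, (∑ u, w u j * c u) ^ 2 = ∑ u, ∑ v, (∑ j, w u j * w v j) * (c u * c v) := by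
    simp_rw [sq]
    rw [swap]
    refine Finset.sum_congr rfl fun u _ => Finset.sum_congr rfl fun v _ => ?_
    rw [Finset.sum_mul]
    exact Finset.sum_congr rfl fun j _ => by ring
  have hA : ∀ u v, ∑ j, w u j * w v j ≤ 1 := fun u v => by
    have h : ∀ j, w u j * w v j ≤ (w u j ^ 2 + w v j ^ 2) / 2 := fun j => by
      nlinarith [sq_nonneg (w u j - w v j)]
    refine (Finset.sum_le_sum fun j _ => h j).trans ?_
    rw [← Finset.sum_div, Finset.sum_add_distrib, hw, hw]
    norm_num
  simp only [Finset.sum_sub_distrib]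
  rw [hd, he, h1, h2, h3, sq c]
  have hfin : (∑ u, ∑ v, ∑ i, a u i * a v i) + ∑ u, ∑ v, (∑ j, w u j * w v j) * (c u * c v)
      ≤ (∑ u, ∑ v, (∑ i, a u i * a v i) * ∑ j, w u j * w v j) + ∑ u, ∑ v, c u * c v := by
    simp only [← Finset.sum_add_distrib]
    refine Finset.sum_le_sum fun u _ => Finset.sum_le_sum fun v _ => ?_
    nlinarith [mul_nonneg (sub_nonneg.2 (hA u v)) (sub_nonneg.2 (hac u v))]
  linarith

/-- The index set of the Gaussian variables in Gordon's comparison: the matrix `A` and a scalar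
on one side, two vectors `g` and `h` on the other. -/
abbrev GordonIndex (m n : ℕ) : Type := ((Fin m × Fin n) ⊕ Unit) ⊕ (Fin m ⊕ Fin n)

/-- Which coordinate of `(z, s)` a Gaussian variable contributes to. -/
def gordonTarget : GordonIndex m n → Option (Fin m)
  | .inl (.inl ij) => some ij.1
  | .inl (.inr _) => none
  | .inr (.inl i) => some i
  | .inr (.inr _) => none

/-- The coefficient of a Gaussian variable in the process at `w`. -/
def gordonCoeff (w : Fin n → ℝ) : GordonIndex m n → ℝ
  | .inl (.inl ij) => w ij.2
  | .inl (.inr _) => 1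
  | .inr (.inl _) => 1
  | .inr (.inr j) => w j

/-- The process `N(A w) + g₀`. -/
noncomputable def bilinearSide (w : Fin n → ℝ) (x : GordonIndex m n → ℝ) : ℝ :=
  smoothNorm (fun i => ∑ j, w j * x (.inl (.inl (i, j)))) + x (.inl (.inr ()))

/-- The process `N(g) + ⟨h, w⟩`. -/
noncomputable def linearSide (w : Fin n → ℝ) (x : GordonIndex m n → ℝ) : ℝ :=
  smoothNorm (fun i => x (.inr (.inl i))) + ∑ j, w j * x (.inr (.inr j))

theorem continuous_bilinearSide (w : Fin n → ℝ) : Continuous (bilinearSide (m := m) w) := by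
  unfold bilinearSide
  exact (continuous_smoothNorm.comp (by fun_prop)).add (by fun_prop)

theorem continuous_linearSide (w : Fin n → ℝ) : Continuous (linearSide (m := m) w) := by
  unfold linearSide
  exact (continuous_smoothNorm.comp (by fun_prop)).add (by fun_prop)

theorem potential_bilinearSide (l t : ℝ) (w : Fin n → ℝ) (x : GordonIndex m n → ℝ) :
    potential l t (fiberSum gordonTarget (gordonCoeff w)
      (Sum.elim (fun a => x (Sum.inl a)) 0)) = Real.exp (-(l * (bilinearSide w x - t))) := by
  simp [potential, bilinearSide, fiberSum_apply, gordonTarget, gordonCoeff,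
    Fintype.sum_prod_type, Finset.sum_ite_eq', ite_mul, Finset.sum_ite_irrel]

theorem potential_linearSide (l t : ℝ) (w : Fin n → ℝ) (x : GordonIndex m n → ℝ) :
    potential l t (fiberSum gordonTarget (gordonCoeff w)
      (Sum.elim 0 (fun a => x (Sum.inr a)))) = Real.exp (-(l * (linearSide w x - t))) := by
  simp [potential, linearSide, fiberSum_apply, gordonTarget, gordonCoeff]

theorem abs_gordonCoeff_le_one {w : Fin n → ℝ} (hw : ∑ j, w j ^ 2 = 1) (a : GordonIndex m n) :
    |gordonCoeff w a| ≤ 1 := by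
  have h : ∀ j, |w j| ≤ 1 := fun j => by
    rw [← sq_le_one_iff_abs_le_one, ← hw]
    exact Finset.single_le_sum (f := fun j => w j ^ 2) (fun j _ => sq_nonneg _) (Finset.mem_univ j)
  rcases a with ((⟨i, j⟩ | _) | (i | j)) <;> simp [gordonCoeff, h]

/-- The integrand is a smooth version of the indicator that every process value exceeds `t`. The
scalar in `bilinearSide` balances the variances of the two processes, leaving a trace difference of
definite sign. -/
theorem gordon_integral_le {w : J → Fin n → ℝ} (hw : ∀ u, ∑ j, w u j ^ 2 = 1) {l : ℝ} (hl : 0 ≤ l)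
    (t : ℝ) :
    ∫ x, Real.exp (-∑ u, Real.exp (-(l * (linearSide (w u) x - t)))) ∂gaussPi (GordonIndex m n)
      ≤ ∫ x, Real.exp (-∑ u, Real.exp (-(l * (bilinearSide (w u) x - t))))
        ∂gaussPi (GordonIndex m n) := by
  have h1 := hasFDerivAt_potential (m := m) l t
  have h2 := exists_hasFDerivAt_potential1 (m := m) l t
  set κ : GordonIndex m n → J → ℝ := fun a u => gordonCoeff (w u) a with hκ
  have hb := softMin_bounds (ψ := potential l t) (ψ1 := fun β p => -(l * potential l t p * slope β p))
    (ψ2 := fun β p => potential l t p * (l ^ 2 * slope β p ^ 2 - l * curvature β p))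
    (gordonTarget (m := m) (n := n)) κ (K := l ^ 2 + l) (by positivity)
    (fun p => (Real.exp_pos _).le)
    (fun β p => by
      have hp : 0 < potential l t p := Real.exp_pos _
      have := abs_slope_le_one β p
      rw [abs_neg, abs_mul, abs_mul, abs_of_nonneg hl, abs_of_pos hp]
      calc l * potential l t p * |slope β p| ≤ l * potential l t p * 1 := by gcongr
        _ ≤ (l ^ 2 + l) * potential l t p := by nlinarith [mul_nonneg (sq_nonneg l) hp.le])
    (fun β p => by
      have hp : 0 < potential l t p := Real.exp_pos _
      rw [abs_mul, abs_of_pos hp, mul_comm]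
      refine mul_le_mul_of_nonneg_right ?_ hp.le
      refine (abs_sub _ _).trans ?_
      rw [abs_mul, abs_mul, abs_of_nonneg hl, abs_of_nonneg (sq_nonneg l), abs_pow]
      have a1 : |slope β p| ^ 2 ≤ 1 := pow_le_one₀ (abs_nonneg _) (abs_slope_le_one β p)
      have a2 := abs_curvature_le_one β p
      nlinarith [sq_nonneg l])
    (fun a u => abs_gordonCoeff_le_one (hw u) a)
  have hcψ := continuous_potential (m := m) l t
  have hcs : Continuous (softMin (potential l t) (gordonTarget (m := m) (n := n)) κ) := by
    unfold softMin; fun_prop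
  have hcomp := integral_comparison (hasFDerivAt_softMin gordonTarget κ h1)
    (hasDerivAt_softMin1 gordonTarget κ h1 h2)
    (fun a => by
      have := continuous_slope (m := m) (gordonTarget (n := n) a)
      unfold softMin1; fun_prop)
    (fun a => by
      have := continuous_slope (m := m) (gordonTarget (n := n) a)
      have := continuous_curvature (m := m) (gordonTarget (n := n) a)
      unfold softMin2; fun_prop)
    (fun y => (hb y).1) (fun a y => (hb y).2.1 a) (fun a y => (hb y).2.2 a)
    (fun y => by
      have hG : 0 ≤ softMin (potential l t) (gordonTarget (m := m) (n := n)) κ y :=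
        (Real.exp_pos _).le
      simp only [softMin2, ← Finset.mul_sum]
      refine mul_le_mul_of_nonneg_left ?_ hG
      rw [Fintype.sum_sum_type, Fintype.sum_sum_type]
      set p : J → Option (Fin m) → ℝ := fun u => fiberSum gordonTarget (κ · u) y with hp
      have htr := gordon_trace_le hw
        (a := fun u i => -(l * potential l t (p u) * slope (some i) (p u)))
        (d := fun u i => potential l t (p u) *
          (l ^ 2 * slope (some i) (p u) ^ 2 - l * curvature (some i) (p u)))
        (c := fun u => -(l * potential l t (p u) * slope none (p u)))
        (e := fun u => potential l t (p u) *
          (l ^ 2 * slope none (p u) ^ 2 - l * curvature none (p u)))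
        -- Both products carry the factor `l ^ 2` times two potentials, and the slope in the
        -- direction `none` is `1`; the claim is thus the Cauchy–Schwarz bound for the other slopes.
        (fun u v => by
          have h := sum_slope_mul_slope_le (p u) (p v)
          have hpos : 0 ≤ l ^ 2 * (potential l t (p u) * potential l t (p v)) :=
            mul_nonneg (sq_nonneg l) (mul_nonneg (Real.exp_pos _).le (Real.exp_pos _).le)
          have := mul_le_mul_of_nonneg_left h hpos
          rw [Finset.mul_sum] at this
          calc _ = ∑ i, l ^ 2 * (potential l t (p u) * potential l t (p v)) *
                (slope (some i) (p u) * slope (some i) (p v)) :=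
                Finset.sum_congr rfl fun i _ => by ring
            _ ≤ _ := this
            _ = _ := by simp only [slope]; ring)
      have k₁ : ∀ ij u, κ (.inl (.inl ij)) u = w u ij.2 := fun _ _ => rfl
      have k₂ : ∀ z u, κ (.inl (.inr z)) u = 1 := fun _ _ => rfl
      have k₃ : ∀ i u, κ (.inr (.inl i)) u = 1 := fun _ _ => rfl
      have k₄ : ∀ j u, κ (.inr (.inr j)) u = w u j := fun _ _ => rfl
      simpa [k₁, k₂, k₃, k₄, gordonTarget, hp] using htr)
  simp only [softMin, hκ, potential_bilinearSide, potential_linearSide] at hcomp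
  exact hcomp

/-- A single value below `-η` makes the soft indicator doubly exponentially small in `l`. Together
with `le_exp_neg_sum_exp` this recovers the sharp events as `l` tends to infinity. -/
theorem exp_neg_sum_exp_le {f : J → ℝ} {l η : ℝ} (hl : 0 ≤ l) {u : J} (hu : f u ≤ -η) :
    Real.exp (-∑ u, Real.exp (-(l * f u))) ≤ Real.exp (-Real.exp (l * η)) := by
  refine Real.exp_le_exp.2 (neg_le_neg ?_)
  refine le_trans ?_ (Finset.single_le_sum (f := fun u => Real.exp (-(l * f u)))
    (fun u _ => (Real.exp_pos _).le) (Finset.mem_univ u))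
  exact Real.exp_le_exp.2 (by nlinarith)

theorem le_exp_neg_sum_exp {f : J → ℝ} {l η : ℝ} (hl : 0 ≤ l) (hf : ∀ u, η ≤ f u) :
    Real.exp (-(Fintype.card J * Real.exp (-(l * η))))
      ≤ Real.exp (-∑ u, Real.exp (-(l * f u))) := by
  refine Real.exp_le_exp.2 (neg_le_neg ?_)
  calc ∑ u, Real.exp (-(l * f u)) ≤ ∑ _u : J, Real.exp (-(l * η)) :=
        Finset.sum_le_sum fun u _ => Real.exp_le_exp.2 (by nlinarith [hf u])
    _ = _ := by simp

/-- Gordon's comparison inequality for the smoothed norm and finitely many unit vectors. -/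
theorem gordon_comparison {w : J → Fin n → ℝ} (hw : ∀ u, ∑ j, w u j ^ 2 = 1) {s t : ℝ}
    (hst : s < t) :
    (gaussPi (GordonIndex m n)).real {x | ∃ u, bilinearSide (w u) x < s}
      ≤ (gaussPi (GordonIndex m n)).real {x | ∃ u, linearSide (w u) x < t} := by
  set μ := gaussPi (GordonIndex m n) with hμ
  -- The soft threshold `r` is the midpoint, so both events stay at distance `η` from it and both
  -- error terms vanish in the limit.
  set η := (t - s) / 2 with hη
  have hη0 : 0 < η := by rw [hη]; linarith
  set r := (s + t) / 2 with hr
  set E₁ := {x : GordonIndex m n → ℝ | ∃ u, bilinearSide (w u) x < s} with hE₁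
  set E₂ := {x : GordonIndex m n → ℝ | ∃ u, linearSide (w u) x < t} with hE₂
  have hm₁ : MeasurableSet E₁ := by
    rw [hE₁, Set.ofPred_exists]
    exact MeasurableSet.iUnion fun u =>
      measurableSet_lt (continuous_bilinearSide _).measurable measurable_const
  have hm₂ : MeasurableSet E₂ := by
    rw [hE₂, Set.ofPred_exists]
    exact MeasurableSet.iUnion fun u =>
      measurableSet_lt (continuous_linearSide _).measurable measurable_const
  have hint : ∀ (F : J → (GordonIndex m n → ℝ) → ℝ) (l : ℝ), (∀ u, Continuous (F u)) →
      Integrable (fun x => Real.exp (-∑ u, Real.exp (-(l * (F u x - r))))) μ := fun F l hF =>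
    integrable_of_bdd (C := 1) (by fun_prop) fun x => by
      rw [abs_of_pos (Real.exp_pos _), Real.exp_le_one_iff, neg_nonpos]
      exact Finset.sum_nonneg fun u _ => (Real.exp_pos _).le
  have key : ∀ l : ℝ, 0 ≤ l →
      Real.exp (-(Fintype.card J * Real.exp (-(l * η)))) * μ.real E₂ᶜ
        ≤ μ.real E₁ᶜ + Real.exp (-Real.exp (l * η)) := by
    intro l hl
    have hlow : Real.exp (-(Fintype.card J * Real.exp (-(l * η)))) * μ.real E₂ᶜ
        ≤ ∫ x, Real.exp (-∑ u, Real.exp (-(l * (linearSide (w u) x - r)))) ∂μ := by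
      rw [mul_comm, ← smul_eq_mul, ← integral_indicator_const _ hm₂.compl]
      refine integral_mono ((integrable_const _).indicator hm₂.compl)
        (hint _ l fun u => continuous_linearSide _) fun x => ?_
      refine Set.indicator_apply_le' (fun hx => ?_) fun _ => (Real.exp_pos _).le
      refine le_exp_neg_sum_exp hl fun u => ?_
      have : t ≤ linearSide (w u) x := not_lt.1 fun h => hx ⟨u, h⟩
      rw [hη, hr]; linarith
    have hup : ∫ x, Real.exp (-∑ u, Real.exp (-(l * (bilinearSide (w u) x - r)))) ∂μ
        ≤ μ.real E₁ᶜ + Real.exp (-Real.exp (l * η)) := by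
      have e : μ.real E₁ᶜ + Real.exp (-Real.exp (l * η))
          = ∫ x, (E₁ᶜ.indicator (fun _ => (1 : ℝ)) x + Real.exp (-Real.exp (l * η))) ∂μ := by
        rw [integral_add ((integrable_const _).indicator hm₁.compl) (integrable_const _),
          integral_indicator_const _ hm₁.compl]
        simp
      rw [e]
      refine integral_mono (hint _ l fun u => continuous_bilinearSide _)
        (((integrable_const _).indicator hm₁.compl).add (integrable_const _)) fun x => ?_
      by_cases hx : x ∈ E₁
      · obtain ⟨u, hu⟩ := hx
        have h := exp_neg_sum_exp_le (f := fun u => bilinearSide (w u) x - r) (η := η) hl (u := u)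
          (by rw [hη, hr]; linarith)
        exact h.trans (le_add_of_nonneg_left (Set.indicator_nonneg (fun _ _ => zero_le_one) x))
      · have h1 : Real.exp (-∑ u, Real.exp (-(l * (bilinearSide (w u) x - r)))) ≤ 1 := by
          rw [Real.exp_le_one_iff, neg_nonpos]
          exact Finset.sum_nonneg fun u _ => (Real.exp_pos _).le
        have h2 : E₁ᶜ.indicator (fun _ => (1 : ℝ)) x = 1 :=
          Set.indicator_of_mem (s := E₁ᶜ) hx _
        simp only [h2]
        linarith [Real.exp_pos (-Real.exp (l * η))]
    exact hlow.trans ((gordon_integral_le hw hl r).trans hup)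
  have hlη : Filter.Tendsto (fun l : ℝ => l * η) Filter.atTop Filter.atTop :=
    Filter.tendsto_id.atTop_mul_const hη0
  have hlim₁ : Filter.Tendsto
      (fun l : ℝ => Real.exp (-(Fintype.card J * Real.exp (-(l * η)))) * μ.real E₂ᶜ)
      Filter.atTop (nhds (μ.real E₂ᶜ)) := by
    have h := Real.tendsto_exp_neg_atTop_nhds_zero.comp hlη
    have h2 := ((Real.continuous_exp.tendsto _).comp
      (h.const_mul (Fintype.card J : ℝ)).neg).mul_const (μ.real E₂ᶜ)
    simpa using h2
  have hlim₂ : Filter.Tendsto (fun l : ℝ => μ.real E₁ᶜ + Real.exp (-Real.exp (l * η)))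
      Filter.atTop (nhds (μ.real E₁ᶜ)) := by
    have h := (Real.tendsto_exp_neg_atTop_nhds_zero.comp
      (Real.tendsto_exp_atTop.comp hlη)).const_add (μ.real E₁ᶜ)
    simpa using h
  have hle := le_of_tendsto_of_tendsto hlim₁ hlim₂
    (Filter.eventually_atTop.2 ⟨0, fun l hl => key l hl⟩)
  rw [probReal_compl_eq_one_sub hm₁, probReal_compl_eq_one_sub hm₂] at hle
  linarith

end Gordon

end SectionalLq

namespace SectionalLq

/-! ### Escape through a mesh -/

theorem map_eq_gaussPi {Ω ι : Type*} [MeasurableSpace Ω] [Fintype ι] {P : Measure Ω}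
    [IsProbabilityMeasure P] {X : ι → Ω → ℝ} (h : ∀ i, HasLaw (X i) (gaussianReal 0 1) P)
    (hi : iIndepFun X P) : P.map (fun ω i => X i ω) = gaussPi ι := by
  rw [(iIndepFun_iff_map_fun_eq_pi_map fun i => (h i).aemeasurable).1 hi]
  simp_rw [(h _).map_eq]

theorem iIndepFun_eval (ι : Type*) [Fintype ι] :
    iIndepFun (fun (i : ι) (x : ι → ℝ) => x i) (gaussPi ι) :=
  iIndepFun_pi (X := fun _ => id) fun _ => aemeasurable_id

theorem hasLaw_eval {ι : Type*} [Fintype ι] (i : ι) :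
    HasLaw (fun x : ι → ℝ => x i) (gaussianReal 0 1) (gaussPi ι) :=
  ⟨(measurable_pi_apply i).aemeasurable,
    (measurePreserving_eval (fun _ : ι => gaussianReal 0 1) i).map_eq⟩

theorem map_comp_gaussPi {ι κ : Type*} [Fintype ι] [Fintype κ] {e : κ → ι}
    (he : Function.Injective e) : (gaussPi ι).map (fun x k => x (e k)) = gaussPi κ :=
  map_eq_gaussPi (fun k => hasLaw_eval (e k)) ((iIndepFun_eval ι).precomp he)

variable {m n : ℕ}

/-- Gordon's inequality is available for finite families of unit vectors only. The net lies inside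
`S`, so its points keep the unit norm and count as members of `S` on the decoupled side. -/
theorem exists_finite_net {S : Set (Fin n → ℝ)} (hS : ∀ w ∈ S, ∑ j, w j ^ 2 = 1) {δ : ℝ}
    (hδ : 0 < δ) : ∃ W ⊆ S, W.Finite ∧ ∀ w ∈ S, ∃ w' ∈ W, ∀ j, |w j - w' j| < δ := by
  have hb : S ⊆ Metric.closedBall 0 1 := fun w hw => by
    rw [mem_closedBall_zero_iff, pi_norm_le_iff_of_nonneg zero_le_one]
    intro j
    rw [Real.norm_eq_abs, ← sq_le_one_iff_abs_le_one, ← hS w hw]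
    exact Finset.single_le_sum (f := fun j => w j ^ 2) (fun j _ => sq_nonneg _) (Finset.mem_univ j)
  have ht : TotallyBounded S := (isCompact_closedBall _ _).totallyBounded.subset hb
  obtain ⟨W, hWS, hWf, hW⟩ := ht.exists_subset (Metric.dist_mem_uniformity hδ)
  refine ⟨W, hWS, hWf, fun w hw => ?_⟩
  obtain ⟨w', hw', hd⟩ := Set.mem_iUnion₂.1 (hW hw)
  exact ⟨w', hw', fun j => (dist_le_pi_dist w w' j).trans_lt hd⟩

/-- The mesh keeps each of the `m` coordinates of `M w'` below `1 / (m + 1)`, so `|M w'| ≤ 1` and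
the smoothed norm is at most `√2`. -/
theorem smoothNorm_lt_two {M : Fin m → Fin n → ℝ} {R : ℝ} (hR : 0 ≤ R) (hM : ∀ i j, |M i j| ≤ R)
    {w w' : Fin n → ℝ} (h0 : ∀ i, ∑ j, M i j * w j = 0)
    (hd : ∀ j, |w j - w' j| < 1 / ((m + 1) * ((n + 1) * (R + 1)))) :
    smoothNorm (fun i => ∑ j, w' j * M i j) < 2 := by
  have hm : (0 : ℝ) < m + 1 := by positivity
  have hi : ∀ i, |∑ j, w' j * M i j| ≤ 1 / (m + 1) := fun i => by
    have e : ∑ j, w' j * M i j = -∑ j, M i j * (w j - w' j) := by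
      simp only [mul_sub, Finset.sum_sub_distrib, h0 i, zero_sub, neg_neg]
      exact Finset.sum_congr rfl fun j _ => mul_comm _ _
    rw [e, abs_neg]
    calc |∑ j, M i j * (w j - w' j)|
        ≤ ∑ _j : Fin n, R * (1 / ((m + 1) * ((n + 1) * (R + 1)))) := by
          refine (Finset.abs_sum_le_sum_abs _ _).trans (Finset.sum_le_sum fun j _ => ?_)
          rw [abs_mul]
          exact mul_le_mul (hM i j) (hd j).le (abs_nonneg _) hR
      _ = 1 / (m + 1) * (n * R / ((n + 1) * (R + 1))) := by
          rw [Finset.sum_const, Finset.card_univ, Fintype.card_fin, nsmul_eq_mul]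
          field_simp
      _ ≤ 1 / (m + 1) * 1 := by
          gcongr
          rw [div_le_one (by positivity)]
          gcongr <;> linarith
      _ = _ := mul_one _
  have hs : ∑ i, (∑ j, w' j * M i j) ^ 2 ≤ 1 := by
    calc ∑ i, (∑ j, w' j * M i j) ^ 2 ≤ ∑ _i : Fin m, (1 / ((m : ℝ) + 1)) ^ 2 :=
          Finset.sum_le_sum fun i _ => sq_le_sq' (by linarith [neg_le_of_abs_le (hi i)])
            (le_of_abs_le (hi i))
      _ = m / (m + 1) ^ 2 := by
          rw [Finset.sum_const, Finset.card_univ, Fintype.card_fin, nsmul_eq_mul]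
          field_simp
      _ ≤ 1 := by
          rw [div_le_one (by positivity)]
          nlinarith [(Nat.cast_nonneg m : (0 : ℝ) ≤ m)]
  rw [smoothNorm, Real.sqrt_lt' two_pos]
  linarith

/-- Escape through a mesh: the kernel of a Gaussian matrix avoids a set of unit vectors, up to the
failure probability of the decoupled problem. -/
theorem measure_exists_mulVec_eq_zero_le {Ω : Type*} [MeasurableSpace Ω] {P : Measure Ω}
    [IsProbabilityMeasure P] {A : Ω → Matrix (Fin m) (Fin n) ℝ} (hA : IsGaussianMatrix P A)
    {S : Set (Fin n → ℝ)} (hS : ∀ w ∈ S, ∑ j, w j ^ 2 = 1) {s t : ℝ} (hst : s < t) :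
    P {ω | ∃ w ∈ S, (A ω).mulVec w = 0}
      ≤ gaussPi (GordonIndex m n) {x | ∃ w ∈ S, linearSide w x < t}
        + gaussPi (GordonIndex m n) {x | s - 2 ≤ x (.inl (.inr ()))} := by
  set μ := gaussPi (GordonIndex m n) with hμ
  -- The mesh depends on a bound for the entries. The truncated events increase with `R` to cover
  -- the event, and the bound below is uniform in `R`.
  set B : ℕ → Set Ω := fun R =>
    {ω | ∃ w ∈ S, (A ω).mulVec w = 0 ∧ ∀ i j, |A ω i j| ≤ R} with hB
  have hmono : Monotone B := fun R R' hRR ω ⟨w, hw, h0, h⟩ =>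
    ⟨w, hw, h0, fun i j => (h i j).trans (Nat.cast_le.2 hRR)⟩
  have hcover : {ω | ∃ w ∈ S, (A ω).mulVec w = 0} ⊆ ⋃ R, B R := by
    rintro ω ⟨w, hw, h0⟩
    obtain ⟨R, hR⟩ := exists_nat_ge (∑ i, ∑ j, |A ω i j|)
    refine Set.mem_iUnion.2 ⟨R, w, hw, h0, fun i j => le_trans ?_ hR⟩
    refine le_trans ?_ (Finset.single_le_sum (f := fun i => ∑ j, |A ω i j|)
      (fun i _ => Finset.sum_nonneg fun j _ => abs_nonneg _) (Finset.mem_univ i))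
    exact Finset.single_le_sum (f := fun j => |A ω i j|) (fun j _ => abs_nonneg _)
      (Finset.mem_univ j)
  refine (measure_mono hcover).trans ?_
  rw [hmono.measure_iUnion]
  refine iSup_le fun R => ?_
  obtain ⟨W, hWS, hWf, hW⟩ := exists_finite_net hS
    (δ := 1 / (((m : ℝ) + 1) * ((n + 1) * ((R : ℝ) + 1)))) (by positivity)
  have : Fintype W := hWf.fintype
  set E : Set (Fin m × Fin n → ℝ) :=
    {M | ∃ u : W, smoothNorm (fun i => ∑ j, (u : Fin n → ℝ) j * M (i, j)) < 2} with hE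
  have hEm : MeasurableSet E := by
    rw [hE, Set.ofPred_exists]
    refine MeasurableSet.iUnion fun u => measurableSet_lt (Continuous.measurable ?_)
      measurable_const
    exact continuous_smoothNorm.comp (by fun_prop)
  have hsub : B R ⊆ (fun ω (p : Fin m × Fin n) => A ω p.1 p.2) ⁻¹' E := by
    rintro ω ⟨w, hw, h0, hR⟩
    obtain ⟨w', hw', hd⟩ := hW w hw
    refine ⟨⟨w', hw'⟩, smoothNorm_lt_two (Nat.cast_nonneg R) hR (w := w) (fun i => ?_) hd⟩
    simpa [Matrix.mulVec, dotProduct] using congrFun h0 i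
  have hlawA := map_eq_gaussPi (fun p : Fin m × Fin n => hA.1 p.1 p.2) hA.2
  have hlawG := map_comp_gaussPi (ι := GordonIndex m n) (κ := Fin m × Fin n)
    (e := fun p => .inl (.inl p)) (fun p p' h => by simpa using h)
  have hAm : AEMeasurable (fun ω (p : Fin m × Fin n) => A ω p.1 p.2) P :=
    aemeasurable_pi_lambda _ fun p => (hA.1 p.1 p.2).aemeasurable
  have hgordon := gordon_comparison (m := m) (w := fun u : W => (u : Fin n → ℝ))
    (fun u => hS _ (hWS u.2)) hst
  rw [measureReal_def, measureReal_def,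
    ENNReal.toReal_le_toReal (measure_ne_top _ _) (measure_ne_top _ _)] at hgordon
  calc P (B R) ≤ P ((fun ω (p : Fin m × Fin n) => A ω p.1 p.2) ⁻¹' E) := measure_mono hsub
    _ = gaussPi (Fin m × Fin n) E := by rw [← hlawA, Measure.map_apply_of_aemeasurable hAm hEm]
    _ = μ ((fun (x : GordonIndex m n → ℝ) p => x (.inl (.inl p))) ⁻¹' E) := by
        rw [← hlawG, Measure.map_apply (by fun_prop) hEm]
    _ ≤ μ ({x | ∃ u : W, bilinearSide (u : Fin n → ℝ) x < s}
          ∪ {x | s - 2 ≤ x (.inl (.inr ()))}) := by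
        refine measure_mono ?_
        rintro x ⟨u, hu⟩
        -- The smoothed norm of a net point near the kernel is below `2`, so the process is below
        -- `s` unless the scalar is at least `s - 2`.
        by_cases hx : s - 2 ≤ x (.inl (.inr ()))
        · exact Or.inr hx
        · refine Or.inl ⟨u, ?_⟩
          rw [bilinearSide]
          linarith
    _ ≤ _ := (measure_union_le _ _).trans <| add_le_add_left (hgordon.trans <| measure_mono <| by
        rintro x ⟨u, hu⟩
        exact ⟨u, hWS u.2, hu⟩) _

end SectionalLq

namespace SectionalLq

/-! ### Chernoff bounds for sums of functions of Gaussian coordinates -/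

/-- A cumulant generating function vanishes at `0` with slope the mean. The difference of the two
sides therefore has negative derivative at `0`, and a small `s > 0` works. -/
theorem exists_cgf_lt {X Y : ℝ → ℝ} {μ : Measure ℝ} [IsProbabilityMeasure μ]
    (hX : 0 ∈ interior (integrableExpSet X μ)) (hY : 0 ∈ interior (integrableExpSet Y μ))
    (a b : ℝ) {T : ℝ} (hT : a * μ[X] + b * μ[Y] < T) :
    ∃ s, 0 ≤ s ∧ s ∈ integrableExpSet X μ ∧ s ∈ integrableExpSet Y μ ∧
      a * cgf X μ s + b * cgf Y μ s < s * T := by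
  have dX := (analyticAt_cgf hX).differentiableAt.hasDerivAt
  have dY := (analyticAt_cgf hY).differentiableAt.hasDerivAt
  rw [deriv_cgf_zero hX, probReal_univ, div_one] at dX
  rw [deriv_cgf_zero hY, probReal_univ, div_one] at dY
  have hd := ((dX.const_mul a).add (dY.const_mul b)).sub ((hasDerivAt_id (0 : ℝ)).mul_const T)
  have hneg : a * μ[X] + b * μ[Y] - 1 * T < 0 := by linarith
  have hsl := hd.tendsto_slope_zero_right.eventually (gt_mem_nhds hneg)
  have hmX : ∀ᶠ s in nhdsWithin (0 : ℝ) (Set.Ioi 0), s ∈ integrableExpSet X μ :=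
    nhdsWithin_le_nhds (mem_interior_iff_mem_nhds.1 hX)
  have hmY : ∀ᶠ s in nhdsWithin (0 : ℝ) (Set.Ioi 0), s ∈ integrableExpSet Y μ :=
    nhdsWithin_le_nhds (mem_interior_iff_mem_nhds.1 hY)
  obtain ⟨s, ⟨⟨h1, h2⟩, h3⟩, hs⟩ :=
    (((hsl.and hmX).and hmY).and self_mem_nhdsWithin).exists
  replace hs : 0 < s := hs
  refine ⟨s, hs.le, h2, h3, ?_⟩
  simp only [zero_add, smul_eq_mul, Pi.sub_apply, Pi.add_apply, id_eq, cgf_zero, mul_zero,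
    zero_mul, sub_zero, add_zero] at h1
  have h4 := (inv_mul_lt_iff₀ hs).1 h1
  linarith

theorem measure_sum_ge_le {ι K : Type*} [Fintype ι] [Fintype K] {e : K → ι}
    (he : Function.Injective e) {f : K → ℝ → ℝ} (hf : ∀ k, Measurable (f k)) {s T : ℝ}
    (hs : 0 ≤ s) (hint : ∀ k, s ∈ integrableExpSet (f k) (gaussianReal 0 1)) :
    (gaussPi ι).real {x | T ≤ ∑ k, f k (x (e k))}
      ≤ Real.exp (-s * T + ∑ k, cgf (f k) (gaussianReal 0 1) s) := by
  have hind : iIndepFun (fun k (x : ι → ℝ) => f k (x (e k))) (gaussPi ι) :=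
    ((iIndepFun_eval ι).precomp he).comp f hf
  have hmeas : ∀ k, Measurable fun x : ι → ℝ => f k (x (e k)) := fun k =>
    (hf k).comp (measurable_pi_apply _)
  have hi : ∀ k, Integrable (fun x : ι → ℝ => Real.exp (s * f k (x (e k)))) (gaussPi ι) :=
    fun k =>
      integrable_comp_eval (μ := fun _ : ι => gaussianReal 0 1) (i := e k)
        (f := fun y => Real.exp (s * f k y)) (hint k)
  have hcgf : ∀ k, cgf (fun x : ι → ℝ => f k (x (e k))) (gaussPi ι) s
      = cgf (f k) (gaussianReal 0 1) s := fun k => by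
    have hlaw := (hasLaw_eval (ι := ι) (e k)).map_eq
    have hev := (hasLaw_eval (ι := ι) (e k)).aemeasurable
    rw [cgf, cgf, ← hlaw, mgf_map hev (by
      have := hf k
      exact Measurable.aestronglyMeasurable (by fun_prop))]
    rfl
  have h := measure_ge_le_exp_cgf (μ := gaussPi ι)
    (X := ∑ k, fun x : ι → ℝ => f k (x (e k))) T hs
    (hind.integrable_exp_mul_sum hmeas fun k _ => hi k)
  rw [hind.cgf_sum hmeas fun k _ => hi k] at h
  simpa [hcgf, Finset.sum_apply] using h

theorem integrable_exp_sq_gaussianReal {c : ℝ} (hc : c < 1 / 2) :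
    Integrable (fun x : ℝ => Real.exp (c * x ^ 2)) (gaussianReal 0 1) := by
  rw [gaussianReal_of_var_ne_zero _ one_ne_zero, integrable_withDensity_iff_integrable_smul'
    (measurable_gaussianPDF _ _) (ae_of_all _ fun _ => gaussianPDF_lt_top)]
  have h := (integrable_exp_neg_mul_sq (b := 1 / 2 - c) (by linarith)).const_mul
    (√(2 * Real.pi * ((1 : ℝ≥0) : ℝ)))⁻¹
  refine h.congr (ae_of_all _ fun x => ?_)
  simp only [toReal_gaussianPDF, gaussianPDFReal_def, smul_eq_mul, NNReal.coe_one, sub_zero]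
  rw [mul_assoc (√_)⁻¹, ← Real.exp_add]
  congr 2
  ring

/-- Nonnegativity handles `s ≤ 0`; for positive `s`, quadratic growth reduces to a Gaussian integral
that converges when `s * b < 1 / 2`. -/
theorem zero_mem_interior_integrableExpSet {X : ℝ → ℝ} (hX : Measurable X) (h0 : ∀ h, 0 ≤ X h)
    {a b : ℝ} (hb : 0 < b) (hle : ∀ h, X h ≤ a + b * h ^ 2) :
    0 ∈ interior (integrableExpSet X (gaussianReal 0 1)) := by
  rw [mem_interior_iff_mem_nhds]
  have hpos : (0 : ℝ) < 1 / (2 * b) := by positivity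
  filter_upwards [Iio_mem_nhds hpos] with s hs
  rw [Set.mem_Iio, lt_div_iff₀ (by positivity)] at hs
  have hm : Measurable fun x => Real.exp (s * X x) := by fun_prop
  rcases le_total s 0 with h | h
  · refine Integrable.of_bound hm.aestronglyMeasurable 1 (ae_of_all _ fun x => ?_)
    rw [Real.norm_eq_abs, abs_of_pos (Real.exp_pos _), Real.exp_le_one_iff]
    exact mul_nonpos_of_nonpos_of_nonneg h (h0 x)
  · have hi := (integrable_exp_sq_gaussianReal (c := s * b) (by linarith)).const_mul
      (Real.exp (s * a))
    refine hi.mono' hm.aestronglyMeasurable (ae_of_all _ fun x => ?_)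
    rw [Real.norm_eq_abs, abs_of_pos (Real.exp_pos _), ← Real.exp_add]
    exact Real.exp_le_exp.2 (by nlinarith [mul_le_mul_of_nonneg_left (hle x) h])

theorem zero_mem_interior_integrableExpSet_neg_sq :
    0 ∈ interior (integrableExpSet (fun x : ℝ => -x ^ 2) (gaussianReal 0 1)) := by
  rw [mem_interior_iff_mem_nhds]
  filter_upwards [Ioi_mem_nhds (show (-1 / 2 : ℝ) < 0 by norm_num)] with s hs
  rw [Set.mem_Ioi] at hs
  refine (integrable_exp_sq_gaussianReal (c := -s) (by linarith)).congr (ae_of_all _ fun x => ?_)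
  simp

theorem integral_neg_sq_gaussianReal : ∫ x, -x ^ 2 ∂gaussianReal 0 1 = -1 := by
  have h := variance_id_gaussianReal (μ := 0) (v := 1)
  rw [variance_eq_integral aemeasurable_id] at h
  simp only [id_eq, integral_id_gaussianReal, sub_zero, NNReal.coe_one] at h
  rw [integral_neg, h]

/-! ### The one-dimensional optimization problems -/

/-- `sup_w (|h||w| + ρ|w|^q - γ w²)`, for `ρ` of either sign. -/
noncomputable def supTerm (q γ ρ h : ℝ) : ℝ≥0∞ :=
  ⨆ w : ℝ, ENNReal.ofReal (|h| * |w| + ρ * absPow q w - γ * w ^ 2)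

theorem I1_eq (q : ℝ) (γ ν : ℝ≥0) : I1 q γ ν = ∫⁻ h, supTerm q γ ν h ∂gaussianReal 0 1 := rfl

theorem I2_eq (q : ℝ) (γ ν : ℝ≥0) : I2 q γ ν = ∫⁻ h, supTerm q γ (-ν) h ∂gaussianReal 0 1 := by
  simp only [I2, supTerm, neg_mul, sub_eq_add_neg]

theorem absPow_nonneg (q w : ℝ) : 0 ≤ absPow q w := by
  unfold absPow; split_ifs <;> positivity

theorem absPow_le {q : ℝ} (hq0 : 0 ≤ q) (hq1 : q ≤ 1) (w : ℝ) : absPow q w ≤ 1 + |w| := by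
  unfold absPow
  split_ifs with h
  · positivity
  · rcases le_total |w| 1 with h1 | h1
    · exact (Real.rpow_le_one (abs_nonneg w) h1 hq0).trans (by linarith [abs_nonneg w])
    · calc |w| ^ q ≤ |w| ^ (1 : ℝ) := Real.rpow_le_rpow_of_exponent_le h1 hq1
        _ ≤ 1 + |w| := by rw [Real.rpow_one]; linarith

/-- The supremum is uncountable, but it is monotone in `|h|`. -/
theorem measurable_supTerm (q γ ρ : ℝ) : Measurable (supTerm q γ ρ) := by
  have hm : Monotone fun a : ℝ => ⨆ w : ℝ, ENNReal.ofReal (a * |w| + ρ * absPow q w - γ * w ^ 2) :=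
    fun a a' h => iSup_mono fun w => ENNReal.ofReal_le_ofReal (by
      have := mul_le_mul_of_nonneg_right h (abs_nonneg w)
      linarith)
  exact hm.measurable.comp measurable_id.abs

/-- Use `|w|^q ≤ 1 + |w|` and complete the square in `|w|`. The quadratic growth in `h` gives
finiteness and exponential moments. -/
theorem supTerm_le {q : ℝ} (hq0 : 0 ≤ q) (hq1 : q ≤ 1) {γ : ℝ} (hγ : 0 < γ) (ρ h : ℝ) :
    supTerm q γ ρ h ≤ ENNReal.ofReal (|ρ| + ρ ^ 2 / (2 * γ) + 1 / (2 * γ) * h ^ 2) := by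
  refine iSup_le fun w => ENNReal.ofReal_le_ofReal ?_
  have h1 : ρ * absPow q w ≤ |ρ| * (1 + |w|) :=
    (mul_le_mul_of_nonneg_right (le_abs_self ρ) (absPow_nonneg q w)).trans
      (mul_le_mul_of_nonneg_left (absPow_le hq0 hq1 w) (abs_nonneg ρ))
  have h2 : (|h| + |ρ|) * |w| - γ * w ^ 2 ≤ (|h| + |ρ|) ^ 2 / (4 * γ) := by
    rw [le_div_iff₀ (by positivity), ← sq_abs w]
    nlinarith [sq_nonneg (|h| + |ρ| - 2 * γ * |w|)]
  have h3 : (|h| + |ρ|) ^ 2 / (4 * γ) ≤ ρ ^ 2 / (2 * γ) + 1 / (2 * γ) * h ^ 2 := by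
    rw [div_add' _ _ _ (by positivity), div_le_div_iff₀ (by positivity) (by positivity)]
    have : 1 / (2 * γ) * h ^ 2 * (2 * γ) = h ^ 2 := by field_simp
    rw [this, ← sq_abs ρ, ← sq_abs h]
    nlinarith [mul_nonneg hγ.le (sq_nonneg (|h| - |ρ|))]
  linarith

/-- The real-valued version of `supTerm`. -/
noncomputable def supVal (q γ ρ h : ℝ) : ℝ := (supTerm q γ ρ h).toReal

theorem measurable_supVal (q γ ρ : ℝ) : Measurable (supVal q γ ρ) :=
  (measurable_supTerm q γ ρ).ennreal_toReal

theorem le_supVal {q : ℝ} (hq0 : 0 ≤ q) (hq1 : q ≤ 1) {γ : ℝ} (hγ : 0 < γ) (ρ h w : ℝ) :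
    |h| * |w| + ρ * absPow q w - γ * w ^ 2 ≤ supVal q γ ρ h := by
  have htop : supTerm q γ ρ h ≠ ∞ := ne_top_of_le_ne_top ENNReal.ofReal_ne_top
    (supTerm_le hq0 hq1 hγ ρ h)
  exact (ENNReal.ofReal_le_iff_le_toReal htop).1
    (le_iSup (fun w : ℝ => ENNReal.ofReal (|h| * |w| + ρ * absPow q w - γ * w ^ 2)) w)

theorem supVal_mem_interior {q : ℝ} (hq0 : 0 ≤ q) (hq1 : q ≤ 1) {γ : ℝ} (hγ : 0 < γ) (ρ : ℝ) :
    0 ∈ interior (integrableExpSet (supVal q γ ρ) (gaussianReal 0 1)) :=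
  zero_mem_interior_integrableExpSet (measurable_supVal q γ ρ) (fun _ => ENNReal.toReal_nonneg)
    (b := 1 / (2 * γ)) (by positivity) fun h =>
      ENNReal.toReal_le_of_le_ofReal (by positivity) (supTerm_le hq0 hq1 hγ ρ h)

theorem lintegral_supTerm {q : ℝ} (hq0 : 0 ≤ q) (hq1 : q ≤ 1) {γ : ℝ} (hγ : 0 < γ) (ρ : ℝ) :
    ∫⁻ h, supTerm q γ ρ h ∂gaussianReal 0 1
      = ENNReal.ofReal (∫ h, supVal q γ ρ h ∂gaussianReal 0 1) := by
  rw [ofReal_integral_eq_lintegral_ofReal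
    (integrable_of_mem_interior_integrableExpSet (supVal_mem_interior hq0 hq1 hγ ρ))
    (ae_of_all _ fun _ => ENNReal.toReal_nonneg)]
  refine lintegral_congr fun h => (ENNReal.ofReal_toReal ?_).symm
  exact ne_top_of_le_ne_top ENNReal.ofReal_ne_top (supTerm_le hq0 hq1 hγ ρ h)

/-- Without the quadratic penalty the linear term is unbounded for `h ≠ 0`. Hence `γ = 0` cannot
witness a finite threshold value when `β > 0`. -/
theorem I1_zero_eq_top (q : ℝ) (ν : ℝ≥0) : I1 q 0 ν = ∞ := by
  have h : ∀ᵐ h ∂gaussianReal 0 1, supTerm q ((0 : ℝ≥0) : ℝ) ν h = ∞ := by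
    have : NullSingletonClass (gaussianReal 0 1) := nullSingletonClass_gaussianReal one_ne_zero
    filter_upwards [Measure.ae_ne (gaussianReal 0 1) 0] with h hh
    refine ENNReal.eq_top_of_forall_nnreal_le fun r => ?_
    set w : ℝ := r / |h| with hw
    refine le_iSup_of_le w ?_
    rw [← ENNReal.ofReal_coe_nnreal]
    refine ENNReal.ofReal_le_ofReal ?_
    have h1 := mul_nonneg ν.2 (absPow_nonneg q w)
    have h2 : |h| * |w| = r := by
      rw [hw, abs_div, abs_abs, NNReal.abs_eq]
      exact mul_div_cancel₀ _ (abs_ne_zero.2 hh)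
    rw [h2]
    simpa using h1
  rw [I1_eq, lintegral_congr_ae h]
  simp

/-- If the threshold is below `√α` and `β > 0`, this is witnessed by some `γ > 0`, with finite
expectations. -/
theorem exists_of_thresholdValue_lt {q β r : ℝ} (hq0 : 0 ≤ q) (hq1 : q ≤ 1) (hβ0 : 0 < β)
    (hβ1 : β ≤ 1) (h : thresholdValue q β < ENNReal.ofReal r) :
    ∃ γ ν : ℝ, 0 < γ ∧ 0 ≤ ν ∧
      β * ∫ h, supVal q γ ν h ∂gaussianReal 0 1
        + (1 - β) * ∫ h, supVal q γ (-ν) h ∂gaussianReal 0 1 + γ < r := by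
  simp only [thresholdValue, iInf_lt_iff] at h
  obtain ⟨γ, ν, h⟩ := h
  have hγ : 0 < (γ : ℝ) := by
    refine lt_of_le_of_ne γ.2 fun h0 => ?_
    have : γ = 0 := NNReal.eq h0.symm
    subst this
    rw [I1_zero_eq_top, ENNReal.mul_top (by simpa using hβ0)] at h
    simp at h
  have hn : ∀ ρ, 0 ≤ ∫ h, supVal q γ ρ h ∂gaussianReal 0 1 := fun ρ =>
    integral_nonneg fun _ => ENNReal.toReal_nonneg
  refine ⟨γ, ν, hγ, ν.2, ?_⟩
  have h1β : 0 ≤ 1 - β := by linarith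
  rw [I1_eq, I2_eq, lintegral_supTerm hq0 hq1 hγ, lintegral_supTerm hq0 hq1 hγ,
    ← ENNReal.ofReal_mul hβ0.le, ← ENNReal.ofReal_mul h1β, ← ENNReal.ofReal_coe_nnreal,
    ← ENNReal.ofReal_add (mul_nonneg hβ0.le (hn _)) (mul_nonneg h1β (hn _)),
    ← ENNReal.ofReal_add (add_nonneg (mul_nonneg hβ0.le (hn _)) (mul_nonneg h1β (hn _))) hγ.le] at h
  exact (ENNReal.ofReal_lt_ofReal_iff'.1 h).1

end SectionalLq

namespace SectionalLq

/-! ### Reduction to the null space -/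

theorem absPow_of_pos {q : ℝ} (hq : 0 < q) (w : ℝ) : absPow q w = |w| ^ q := by
  unfold absPow
  split_ifs with h
  · simp [h, Real.zero_rpow hq.ne']
  · rfl

theorem absPow_neg (q w : ℝ) : absPow q (-w) = absPow q w := by
  simp [absPow]

theorem absPow_add_le {q : ℝ} (hq0 : 0 ≤ q) (hq1 : q ≤ 1) (a b : ℝ) :
    absPow q (a + b) ≤ absPow q a + absPow q b := by
  by_cases ha : a = 0
  · simp [ha, absPow]
  by_cases hb : b = 0
  · simp [hb, absPow]
  by_cases hab : a + b = 0
  · rw [hab, absPow, if_pos rfl]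
    exact add_nonneg (absPow_nonneg q a) (absPow_nonneg q b)
  · simp only [absPow, ha, hb, hab, if_false]
    exact (Real.rpow_le_rpow (abs_nonneg _) (abs_add_le a b) hq0).trans
      (Real.rpow_add_le_add_rpow (abs_nonneg a) (abs_nonneg b) hq0 hq1)

theorem absPow_mul {c : ℝ} (hc : 0 < c) (q w : ℝ) : absPow q (c * w) = c ^ q * absPow q w := by
  unfold absPow
  by_cases h : w = 0
  · simp [h]
  · rw [if_neg h, if_neg (mul_ne_zero hc.ne' h), abs_mul, abs_of_pos hc,
      Real.mul_rpow hc.le (abs_nonneg w)]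

variable {n : ℕ}

theorem sum_absPow_le_of_lqNorm_le {q : ℝ} (hq0 : 0 ≤ q) {x z : Fin n → ℝ}
    (h : lqNorm q x ≤ lqNorm q z) : ∑ i, absPow q (x i) ≤ ∑ i, absPow q (z i) := by
  rcases hq0.eq_or_lt with rfl | hq
  · rw [lqNorm_zero, lqNorm_zero] at h
    have e : ∀ y : Fin n → ℝ, ∑ i, absPow 0 (y i)
        = ((Finset.univ.filter fun i => y i ≠ 0).card : ℝ) := fun y => by
      rw [Finset.card_filter]
      push_cast
      refine Finset.sum_congr rfl fun i _ => ?_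
      by_cases hi : y i = 0 <;> simp [absPow, hi]
    rwa [e, e]
  · rw [lqNorm_of_pos hq, lqNorm_of_pos hq] at h
    simp only [absPow_of_pos hq]
    exact (Real.rpow_le_rpow_iff (by positivity) (by positivity) (by positivity)).1 h

/-- `-1` on the first `n - k` coordinates, `1` on the last `k` coordinates. -/
def tailSign (n k : ℕ) (j : Fin n) : ℝ := if (j : ℕ) + k < n then -1 else 1

/-- The unit vectors whose `ℓ_q`-mass on the last `k` coordinates dominates the rest. -/
def badDirections (q : ℝ) (n k : ℕ) : Set (Fin n → ℝ) :=
  {w | ∑ j, w j ^ 2 = 1 ∧ 0 ≤ ∑ j, tailSign n k j * absPow q (w j)}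

theorem eq_zero_of_sum_sq_eq_zero {w : Fin n → ℝ} (h : ∑ j, w j ^ 2 = 0) : w = 0 := by
  ext j
  have := (Finset.sum_eq_zero_iff_of_nonneg fun j _ => sq_nonneg (w j)).1 h j (Finset.mem_univ j)
  simpa using this

/-- The witness is `z - x`, normalized. Where `x` vanishes its mass is that of `z`; elsewhere
subadditivity bounds it below by `|x|^q - |z|^q`. Summing, `‖z‖_q ≤ ‖x‖_q` gives the sign. This
covers both a better competitor and a second minimizer. -/
theorem exists_mem_badDirections_of_ne {m : ℕ} {q : ℝ} (hq0 : 0 ≤ q) (hq1 : q ≤ 1) {k : ℕ}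
    {A : Matrix (Fin m) (Fin n) ℝ} {x z : Fin n → ℝ} (hx : x ∈ sectionalVectors n k) (hzx : z ≠ x)
    (hA : A.mulVec z = A.mulVec x) (hle : lqNorm q z ≤ lqNorm q x) :
    ∃ w ∈ badDirections q n k, A.mulVec w = 0 := by
  have hsum := sum_absPow_le_of_lqNorm_le hq0 hle
  have hN : 0 < ∑ j, (z j - x j) ^ 2 := by
    refine lt_of_le_of_ne (Finset.sum_nonneg fun j _ => sq_nonneg _) fun h => hzx ?_
    have := eq_zero_of_sum_sq_eq_zero (w := z - x) (by simpa using h.symm)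
    exact sub_eq_zero.1 this
  set N := ∑ j, (z j - x j) ^ 2 with hNdef
  have hc : 0 < (√N)⁻¹ := inv_pos.2 (Real.sqrt_pos.2 hN)
  refine ⟨(√N)⁻¹ • (z - x), ⟨?_, ?_⟩, ?_⟩
  · simp only [Pi.smul_apply, Pi.sub_apply, smul_eq_mul, mul_pow, ← Finset.mul_sum, inv_pow,
      Real.sq_sqrt hN.le]
    exact inv_mul_cancel₀ hN.ne'
  · simp only [Pi.smul_apply, Pi.sub_apply, smul_eq_mul, absPow_mul hc]
    have e : ∑ j, tailSign n k j * ((√N)⁻¹ ^ q * absPow q (z j - x j))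
        = (√N)⁻¹ ^ q * ∑ j, tailSign n k j * absPow q (z j - x j) := by
      rw [Finset.mul_sum]
      exact Finset.sum_congr rfl fun j _ => by ring
    rw [e]
    refine mul_nonneg (by positivity) ?_
    have hj : ∀ j, absPow q (x j) - absPow q (z j) ≤ tailSign n k j * absPow q (z j - x j) := by
      intro j
      unfold tailSign
      split_ifs with h
      · have h0 := hx j h
        have h1 : absPow q 0 = 0 := if_pos rfl
        rw [h0, sub_zero, h1]
        linarith
      · have h1 := absPow_add_le hq0 hq1 (z j) (-(z j - x j))
        rw [absPow_neg] at h1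
        have e : z j + -(z j - x j) = x j := by ring
        rw [e] at h1
        linarith
    refine le_trans ?_ (Finset.sum_le_sum fun j _ => hj j)
    rw [Finset.sum_sub_distrib]
    linarith
  · rw [Matrix.mulVec_smul, Matrix.mulVec_sub, hA, sub_self, smul_zero]

/-- The null space property: recovery can only fail along a bad direction in the kernel. -/
theorem exists_mem_badDirections {m : ℕ} {q : ℝ} (hq0 : 0 ≤ q) (hq1 : q ≤ 1) {k : ℕ}
    {A : Matrix (Fin m) (Fin n) ℝ} (h : ¬ RecoversSectional q k A) :
    ∃ w ∈ badDirections q n k, A.mulVec w = 0 := by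
  simp only [RecoversSectional, not_forall] at h
  obtain ⟨x', hx', x, h⟩ := h
  by_cases hx : x = x'
  · subst hx
    have hns : ¬ IsLqSolution q A (A.mulVec x) x := fun hs => h ⟨fun _ => rfl, fun _ => hs⟩
    simp only [IsLqSolution, true_and, not_forall, not_le] at hns
    obtain ⟨z, hz, hlt⟩ := hns
    exact exists_mem_badDirections_of_ne hq0 hq1 hx' (fun e => by simp [e] at hlt) hz hlt.le
  · have hs : IsLqSolution q A (A.mulVec x') x := by
      by_contra hs
      exact h ⟨fun h' => (hs h').elim, fun h' => (hx h').elim⟩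
    exact exists_mem_badDirections_of_ne hq0 hq1 hx' hx hs.1 (hs.2 x' rfl)

/-- Without a tail there is nothing to recover. -/
theorem badDirections_zero (q : ℝ) (n : ℕ) : badDirections q n 0 = ∅ := by
  refine Set.eq_empty_of_forall_notMem fun w ⟨h1, h2⟩ => ?_
  have hs : ∀ j : Fin n, tailSign n 0 j = -1 := fun j => by simp [tailSign]
  simp only [hs, neg_mul, one_mul, Finset.sum_neg_distrib, Left.nonneg_neg_iff] at h2
  have h3 : ∀ j, w j = 0 := fun j => by
    have h4 := (Finset.sum_eq_zero_iff_of_nonneg fun j _ => absPow_nonneg q (w j)).1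
      (le_antisymm h2 (Finset.sum_nonneg fun j _ => absPow_nonneg q (w j))) j (Finset.mem_univ j)
    by_contra hj
    rw [absPow, if_neg hj] at h4
    exact (Real.rpow_pos_of_pos (abs_pos.2 hj) q).ne' h4
  simp [h3] at h1

theorem sum_tailSign_ite {k : ℕ} (hk : k ≤ n) (a b : ℝ) :
    ∑ j : Fin n, (if tailSign n k j = 1 then a else b) = k * a + (n - k) * b := by
  obtain ⟨l, rfl⟩ := Nat.exists_eq_add_of_le' hk
  have e : ∀ j : Fin (l + k), (if tailSign (l + k) k j = 1 then a else b)
      = (fun i : ℕ => if i < l then b else a) j := fun j => by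
    simp only [tailSign, add_lt_add_iff_right]
    split_ifs <;> first | rfl | norm_num at *
  simp_rw [e]
  rw [Fin.sum_univ_eq_sum_range (fun i : ℕ => if i < l then b else a), Finset.sum_range_add]
  have e1 : ∑ i ∈ Finset.range l, (if i < l then b else a) = l * b := by
    rw [Finset.sum_congr rfl fun i hi => if_pos (Finset.mem_range.1 hi)]
    simp
  rw [e1]
  push_cast
  simp
  ring

/-- A linear functional on the bad directions is bounded by the separable relaxation. -/
theorem sqrt_mul_neg_sum_le {q : ℝ} (hq0 : 0 ≤ q) (hq1 : q ≤ 1) {γ ν : ℝ} (hγ : 0 < γ)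
    (hν : 0 ≤ ν) {k : ℕ} {w : Fin n → ℝ} (hw : w ∈ badDirections q n k) (h : Fin n → ℝ) :
    √n * -(∑ j, w j * h j) ≤ ∑ j, supVal q γ (ν * tailSign n k j) (h j) + γ * n := by
  have hn : (0 : ℝ) < n := by
    rcases Nat.eq_zero_or_pos n with rfl | hn
    · simpa using hw.1
    · exact_mod_cast hn
  have hs : 0 < √(n : ℝ) := Real.sqrt_pos.2 hn
  have hj : ∀ j, √n * -(w j * h j) ≤ supVal q γ (ν * tailSign n k j) (h j)
      - ν * (√n ^ q * (tailSign n k j * absPow q (w j))) + γ * n * w j ^ 2 := fun j => by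
    -- Testing the supremum at `√n * w j` gives the test vector squared norm `n`, so that every term
    -- has order `n`.
    have h1 := le_supVal hq0 hq1 hγ (ν * tailSign n k j) (h j) (√n * w j)
    rw [absPow_mul hs, mul_pow, Real.sq_sqrt hn.le, abs_mul, abs_of_pos hs] at h1
    have h2 : -(w j * h j) ≤ |h j| * |w j| := by
      rw [mul_comm, ← abs_mul]; exact neg_le_abs _
    have h3 := mul_le_mul_of_nonneg_left h2 hs.le
    linarith
  have hsum := Finset.sum_le_sum fun j (_ : j ∈ Finset.univ) => hj j
  rw [Finset.sum_add_distrib, Finset.sum_sub_distrib, ← Finset.mul_sum, ← Finset.mul_sum,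
    ← Finset.mul_sum, ← Finset.mul_sum, hw.1, Finset.sum_neg_distrib] at hsum
  -- The multiplier term is nonnegative on bad directions and can be dropped.
  have := mul_nonneg hν (mul_nonneg (Real.rpow_nonneg hs.le q) hw.2)
  linarith

end SectionalLq

/-! ### Large deviations of the decoupled problem and conclusion -/

namespace SectionalLq

/-- Chernoff with tilt `a`: the exponent `3 * a - a ^ 2 / 2` is at most `9 - a ^ 2 / 4`. The shift
`3` is the bound `2` on the smoothed norm plus the gap `1` between the levels in the final
application of Gordon's inequality. -/
theorem measureReal_eval_ge_le {ι : Type*} [Fintype ι] (i : ι) {a : ℝ} (ha : 0 ≤ a) :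
    (gaussPi ι).real {x | a - 3 ≤ x i} ≤ Real.exp 9 * Real.exp (-(a ^ 2 / 4)) := by
  have hmap := (hasLaw_eval (ι := ι) i).map_eq
  have hint : Integrable (fun x : ι → ℝ => Real.exp (a * x i)) (gaussPi ι) :=
    integrable_comp_eval (μ := fun _ : ι => gaussianReal 0 1) (i := i)
      (f := fun y => Real.exp (a * y)) (integrable_exp_mul_gaussianReal a)
  refine (measure_ge_le_exp_mul_mgf (a - 3) ha hint).trans ?_
  rw [mgf_gaussianReal hmap, ← Real.exp_add, ← Real.exp_add]
  refine Real.exp_le_exp.2 ?_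
  simp only [NNReal.coe_one]
  nlinarith [sq_nonneg (a - 6)]

/-- Failure of the decoupled problem forces a large deviation of one of two sums of independent
random variables. -/
theorem linearSide_subset {q : ℝ} (hq0 : 0 ≤ q) (hq1 : q ≤ 1) {γ ν : ℝ} (hγ : 0 < γ) (hν : 0 ≤ ν)
    {m n k : ℕ} (r ε : ℝ) :
    {x : GordonIndex m n → ℝ | ∃ w ∈ badDirections q n k, linearSide w x < √n * ε}
      ⊆ {x | (r - 2 * ε - γ) * n
          ≤ ∑ j, supVal q γ (ν * tailSign n k j) (x (.inr (.inr j)))}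
        ∪ {x | -(r - ε) ^ 2 * n ≤ ∑ i, -x (.inr (.inl i)) ^ 2} := by
  rintro x ⟨w, hw, hlt⟩
  by_cases h2 : -(r - ε) ^ 2 * n ≤ ∑ i, -x (.inr (.inl i)) ^ 2
  · exact Or.inr h2
  refine Or.inl ?_
  have hn : (0 : ℝ) ≤ n := Nat.cast_nonneg n
  have hsq : √(n : ℝ) ^ 2 = n := Real.sq_sqrt hn
  rw [Finset.sum_neg_distrib, not_le] at h2
  have hN : (r - ε) * √n ≤ smoothNorm fun i => x (.inr (.inl i)) := by
    refine (abs_le_of_sq_le_sq' ?_ (zero_le_one.trans (one_le_smoothNorm _))).2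
    rw [smoothNorm_sq, mul_pow, hsq]
    linarith
  have hmain := sqrt_mul_neg_sum_le hq0 hq1 hγ hν hw fun j => x (.inr (.inr j))
  rw [linearSide] at hlt
  -- One `ε` is lost in the norm of `g`, the other in the level `√n * ε`.
  have h3 : (r - 2 * ε) * √n ≤ -∑ j, w j * x (.inr (.inr j)) := by linarith
  have h4 := mul_le_mul_of_nonneg_left h3 (Real.sqrt_nonneg (n : ℝ))
  have h5 : √(n : ℝ) * ((r - 2 * ε) * √n) = (r - 2 * ε) * n := by
    linear_combination (r - 2 * ε) * hsq
  simp only [Set.mem_ofPred_eq]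
  linarith

end SectionalLq

open SectionalLq in
theorem mainTheorem1 (q : ℝ) (hq0 : 0 ≤ q) (hq1 : q ≤ 1)
    (α β : ℝ) (hα : 0 < α) (hβ0 : 0 ≤ β) (hβ1 : β ≤ 1)
    (hcond : SectionalLq.thresholdValue q β < ENNReal.ofReal (Real.sqrt α)) :
    ∃ C c : ℝ, 0 < C ∧ 0 < c ∧
      ∀ m n k : ℕ, (m : ℝ) = α * n → (k : ℝ) = β * n →
        ∀ (Ω : Type*) [MeasurableSpace Ω] (P : Measure Ω) [IsProbabilityMeasure P]
          (A : Ω → Matrix (Fin m) (Fin n) ℝ), SectionalLq.IsGaussianMatrix P A →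
          P {ω | ¬ SectionalLq.RecoversSectional q k (A ω)}
            ≤ ENNReal.ofReal (C * Real.exp (-c * n)) := by
  rcases hβ0.eq_or_lt with rfl | hβ
  -- For `β = 0` the convention `0 * ∞ = 0` means the threshold no longer forces `γ > 0`, but then
  -- `k = 0` and there are no bad directions.
  · refine ⟨1, 1, one_pos, one_pos, fun m n k _ hk Ω _ P _ A _ => ?_⟩
    have hk0 : k = 0 := by simpa using hk
    subst hk0
    have : {ω | ¬ RecoversSectional q 0 (A ω)} = ∅ := by
      refine Set.eq_empty_of_forall_notMem fun ω hω => ?_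
      obtain ⟨w, hw, _⟩ := exists_mem_badDirections hq0 hq1 hω
      simp [badDirections_zero] at hw
    rw [this, measure_empty]
    exact zero_le
  obtain ⟨γ, ν, hγ, hν, hv⟩ := exists_of_thresholdValue_lt hq0 hq1 hβ hβ1 hcond
  set X := supVal q γ ν with hX
  set Y := supVal q γ (-ν) with hY
  set G := gaussianReal 0 1 with hG
  set r := √α with hr
  set v := β * ∫ h, X h ∂G + (1 - β) * ∫ h, Y h ∂G + γ with hvdef
  have hnn : ∀ ρ, 0 ≤ ∫ h, supVal q γ ρ h ∂G := fun ρ =>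
    integral_nonneg fun _ => ENNReal.toReal_nonneg
  have hγv : γ ≤ v := by
    have h1 := mul_nonneg hβ.le (hnn ν)
    have h2 := mul_nonneg (sub_nonneg.2 hβ1) (hnn (-ν))
    linarith
  -- The gap is split in three: `r - 2 * ε = v + ε` still exceeds `v`, so the level `r - 2 * ε - γ`
  -- lies above the mean `v - γ` of the relaxed sum.
  set ε := (r - v) / 3 with hε
  have hε0 : 0 < ε := by rw [hε]; linarith
  have hεr : ε < r := by rw [hε]; linarith
  have hr2 : r ^ 2 = α := Real.sq_sqrt hα.le
  set Z : ℝ → ℝ := fun x => -x ^ 2 with hZ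
  have hXi := supVal_mem_interior hq0 hq1 hγ ν
  have hYi := supVal_mem_interior hq0 hq1 hγ (-ν)
  obtain ⟨s₁, hs₁, hs₁X, hs₁Y, hlt₁⟩ := exists_cgf_lt hXi hYi β (1 - β) (T := r - 2 * ε - γ)
    (by rw [hε]; linarith)
  -- The lower tail of `|g|²` is the upper tail of a sum of `-x ^ 2`, with mean `-α` per unit of
  -- `n`; the level `-(r - ε) ^ 2` is above it since `0 < ε < r`.
  obtain ⟨s₂, hs₂, hs₂Z, -, hlt₂⟩ := exists_cgf_lt zero_mem_interior_integrableExpSet_neg_sq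
    zero_mem_interior_integrableExpSet_neg_sq α 0 (T := -(r - ε) ^ 2)
    (by rw [integral_neg_sq_gaussianReal]; nlinarith)
  rw [zero_mul, add_zero] at hlt₂
  set φ₁ := s₁ * (r - 2 * ε - γ) - (β * cgf X G s₁ + (1 - β) * cgf Y G s₁) with hφ₁
  set φ₂ := s₂ * -(r - ε) ^ 2 - α * cgf Z G s₂ with hφ₂
  have hφ₁0 : 0 < φ₁ := sub_pos.2 hlt₁
  have hφ₂0 : 0 < φ₂ := sub_pos.2 hlt₂
  set c := min (min φ₁ φ₂) (ε ^ 2 / 4) with hc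
  have hc1 : c ≤ φ₁ := (min_le_left _ _).trans (min_le_left _ _)
  have hc2 : c ≤ φ₂ := (min_le_left _ _).trans (min_le_right _ _)
  have hc3 : c ≤ ε ^ 2 / 4 := min_le_right _ _
  -- Two Chernoff events contribute `1` each and the scalar Gaussian tail contributes `exp 9`.
  refine ⟨2 + Real.exp 9, c, by positivity, lt_min (lt_min hφ₁0 hφ₂0) (by positivity),
    fun m n k hm hk Ω _ P _ A hA => ?_⟩
  have hn : (0 : ℝ) ≤ n := Nat.cast_nonneg n
  have hkn : k ≤ n := by
    have : (k : ℝ) ≤ n := by rw [hk]; nlinarith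
    exact_mod_cast this
  have hesc := measure_exists_mulVec_eq_zero_le hA (S := badDirections q n k) (fun w hw => hw.1)
    (s := √n * ε - 1) (t := √n * ε) (by linarith)
  set μ := gaussPi (GordonIndex m n) with hμ
  have hf : ∀ j : Fin n, supVal q γ (ν * tailSign n k j) = if tailSign n k j = 1 then X else Y :=
    fun j => by
      have hne : (-1 : ℝ) ≠ 1 := by norm_num
      by_cases h : (j : ℕ) + k < n <;> simp [tailSign, h, hX, hY, hne]
  have hb₁ : μ.real {x | (r - 2 * ε - γ) * n
      ≤ ∑ j, supVal q γ (ν * tailSign n k j) (x (.inr (.inr j)))} ≤ Real.exp (-c * n) := by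
    refine (measure_sum_ge_le (ι := GordonIndex m n) (K := Fin n)
      (e := fun j => .inr (.inr j)) (fun i j h => by simpa using h)
      (f := fun j => supVal q γ (ν * tailSign n k j)) (fun j => measurable_supVal _ _ _) hs₁
      (fun j => by simp only [hf]; split_ifs; exacts [hs₁X, hs₁Y])).trans ?_
    have e : ∑ j : Fin n, cgf (supVal q γ (ν * tailSign n k j)) G s₁
        = k * cgf X G s₁ + (n - k) * cgf Y G s₁ := by
      rw [← sum_tailSign_ite hkn]
      refine Finset.sum_congr rfl fun j _ => ?_
      rw [hf]
      split_ifs <;> rfl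
    rw [e, hk]
    refine Real.exp_le_exp.2 ?_
    have := mul_le_mul_of_nonneg_right hc1 hn
    rw [hφ₁] at this
    linarith
  have hb₂ : μ.real {x | -(r - ε) ^ 2 * n ≤ ∑ i, -x (.inr (.inl i)) ^ 2}
      ≤ Real.exp (-c * n) := by
    refine (measure_sum_ge_le (ι := GordonIndex m n) (K := Fin m)
      (e := fun i => .inr (.inl i)) (fun i j h => by simpa using h)
      (f := fun _ => Z) (fun _ => by fun_prop) hs₂ (fun _ => hs₂Z)).trans ?_
    rw [Finset.sum_const, Finset.card_univ, Fintype.card_fin, nsmul_eq_mul, hm]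
    refine Real.exp_le_exp.2 ?_
    have := mul_le_mul_of_nonneg_right hc2 hn
    rw [hφ₂] at this
    linarith
  have hb₃ : μ.real {x | √n * ε - 1 - 2 ≤ x (.inl (.inr ()))}
      ≤ Real.exp 9 * Real.exp (-c * n) := by
    have e : √(n : ℝ) * ε - 1 - 2 = √n * ε - 3 := by ring
    rw [e]
    refine (measureReal_eval_ge_le _ (by positivity)).trans ?_
    refine mul_le_mul_of_nonneg_left (Real.exp_le_exp.2 ?_) (Real.exp_pos _).le
    rw [mul_pow, Real.sq_sqrt hn]
    nlinarith [mul_le_mul_of_nonneg_right hc3 hn]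
  have hlin : μ.real {x | ∃ w ∈ badDirections q n k, linearSide w x < √n * ε}
      ≤ Real.exp (-c * n) + Real.exp (-c * n) :=
    (measureReal_mono (linearSide_subset hq0 hq1 hγ hν r ε)).trans
      ((measureReal_union_le _ _).trans (add_le_add hb₁ hb₂))
  calc P {ω | ¬ RecoversSectional q k (A ω)}
      ≤ P {ω | ∃ w ∈ badDirections q n k, (A ω).mulVec w = 0} :=
        measure_mono fun ω hω => exists_mem_badDirections hq0 hq1 hω
    _ ≤ _ := hesc
    _ = ENNReal.ofReal (μ.real {x | ∃ w ∈ badDirections q n k, linearSide w x < √n * ε}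
          + μ.real {x | √n * ε - 1 - 2 ≤ x (.inl (.inr ()))}) := by
        rw [ENNReal.ofReal_add measureReal_nonneg measureReal_nonneg, ofReal_measureReal,
          ofReal_measureReal]
    _ ≤ _ := ENNReal.ofReal_le_ofReal (by linarith)
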